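/- Let $M$ be a mixed graph on a finite vertex set $V$, that is, a finite simple graph $G$ some of whose edges have been given a direction, and let $E$ be its edge set. Let $N$ be its Hermitian adjacency matrix of the second kind, i.e. $N_{uv}=\frac{1+\sqrt3\,\mathbf i}{2}$ if there is a directed edge from $u$ to $v$, $N_{uv}=\frac{1-\sqrt3\,\mathbf i}{2}$ if there is a directed edge from $v$ to $u$, $N_{uv}=1$ if $uv$ is an undirected edge, and $N_{uv}=0$ otherwise. Let $D$ be the diagonal matrix of the vertex degrees in $G$ and $L=D-N$. For $V_1\subseteq V$ let $L[V_1]$ be the principal submatrix of $L$ with rows and columns indexed by $V_1$. For a mixed cycle, traversed in one of its two directions, let $a$ and $b$ be the numbers of its directed edges pointing along and against the traversal. The cycle belongs to $\Phi_2$ if $a-b\equiv 2$ or $4\pmod 6$, to $\Phi_3$ if $a-b\equiv 3\pmod 6$, and to $\Phi_4$ if $a-b\equiv 0\pmod 6$ (this does not depend on the direction of traversal). A substructure $R$ of $M$ is a pair $(V_R,E_R)$ with $V_R\subseteq V$ and $E_R\subseteq E$, where the ends of an edge in $E_R$ need not lie in $V_R$; it is square if $|V_R|=|E_R|$. Its components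 are the classes of the partition of $V_R\sqcup E_R$ generated by the incidences between a vertex of $V_R$ and an edge of $E_R$. A component is a rootless tree if it arises from a tree by deleting one vertex while keeping all the edges. It is unicyclic if the ends of its edges are all among its vertices and it is a connected graph with exactly one cycle. A substructure is of type SI if it is square and each of its components is either a rootless tree or a unicyclic graph whose cycle is not in $\Phi_4$. Theorem 2.7. For every $V_1\subseteq V$, $$\det L[V_1]=\sum_{R}3^{\gamma_1(R)}4^{\gamma_2(R)},$$ where the sum is over all substructures $R$ of $M$ of type SI with $V_R=V_1$, and $\gamma_1(R)$, $\gamma_2(R)$ are the numbers of unicyclic components of $R$ whose cycle lies in $\Phi_2$ and in $\Phi_3$, respectively. -/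

import Mathlib

/-- A mixed graph on `V`: a simple graph `graph` (the underlying graph), some of whose edges are
given a direction. `arc u v` says that the edge `uv` is directed from `u` to `v`; an edge `uv` with
neither `arc u v` nor `arc v u` is undirected. -/
structure MixedGraph (V : Type*) where
  graph : SimpleGraph V
  arc : V → V → Prop
  arc_adj : ∀ u v, arc u v → graph.Adj u v
  arc_asymm : ∀ u v, arc u v → ¬ arc v u

namespace MixedGraph

variable {V : Type*}

open Classical in
/-- The Hermitian adjacency matrix of the second kind. -/
noncomputable def hermitianAdj (M : MixedGraph V) : Matrix V V ℂ :=
  Matrix.of fun i j =>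
    if M.arc i j then (1 + (Real.sqrt 3 : ℂ) * Complex.I) / 2
    else if M.arc j i then (1 - (Real.sqrt 3 : ℂ) * Complex.I) / 2
    else if M.graph.Adj i j then 1
    else 0

open Classical in
/-- The diagonal matrix of the degrees in the underlying graph. -/
noncomputable def degreeMatrix [Fintype V] [DecidableEq V] (M : MixedGraph V) : Matrix V V ℂ :=
  Matrix.diagonal fun v => (M.graph.degree v : ℂ)

/-- The Hermitian Laplacian matrix of the second kind, `L = D - N`. -/
noncomputable def laplacian [Fintype V] [DecidableEq V] (M : MixedGraph V) : Matrix V V ℂ :=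
  M.degreeMatrix - M.hermitianAdj

open Classical in
/-- Number of directed edges of the closed walk `c` that point in its direction of traversal. -/
noncomputable def forwardCount (M : MixedGraph V) {v : V} (c : M.graph.Walk v v) : ℕ :=
  c.darts.countP fun d => M.arc d.fst d.snd

open Classical in
/-- Number of directed edges of the closed walk `c` that point against its direction of
traversal. -/
noncomputable def backwardCount (M : MixedGraph V) {v : V} (c : M.graph.Walk v v) : ℕ :=
  c.darts.countP fun d => M.arc d.snd d.fst

/-- The difference `a - b` of a mixed cycle. It changes its sign with the direction of traversal;
the classes below are invariant under this. -/
noncomputable def excess (M : MixedGraph V) {v : V} (c : M.graph.Walk v v) : ℤ :=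
  (M.forwardCount c : ℤ) - (M.backwardCount c : ℤ)

/-- The class `Φ₂` of mixed cycles. -/
def IsPhi2 (M : MixedGraph V) {v : V} (c : M.graph.Walk v v) : Prop :=
  M.excess c ≡ 2 [ZMOD 6] ∨ M.excess c ≡ 4 [ZMOD 6]

/-- The class `Φ₃` of mixed cycles. -/
def IsPhi3 (M : MixedGraph V) {v : V} (c : M.graph.Walk v v) : Prop :=
  M.excess c ≡ 3 [ZMOD 6]

/-- The class `Φ₄` of mixed cycles. -/
def IsPhi4 (M : MixedGraph V) {v : V} (c : M.graph.Walk v v) : Prop :=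
  M.excess c ≡ 0 [ZMOD 6]

/-- A substructure: a set of vertices and a set of edges of the mixed graph. An edge of a
substructure need not have its end vertices in the substructure. -/
@[ext]
structure Substructure (M : MixedGraph V) where
  verts : Finset V
  edges : Finset (Sym2 V)
  edges_subset : (edges : Set (Sym2 V)) ⊆ M.graph.edgeSet

namespace Substructure

variable {M : MixedGraph V}

open Classical in
noncomputable instance instFintype [Fintype V] : Fintype (Substructure M) :=
  Fintype.ofInjective (fun R : Substructure M => (R.verts, R.edges)) fun _ _ h =>
    Substructure.ext (congrArg Prod.fst h) (congrArg Prod.snd h)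

/-- A square substructure: as many edges as vertices. -/
def IsSquare (R : Substructure M) : Prop :=
  R.verts.card = R.edges.card

/-- The incidence relation of a substructure, as a graph on its vertices and edges together: a
vertex `v` of `R` is joined to an edge `e` of `R` if `v` is an end vertex of `e`. -/
def incidence (R : Substructure M) : SimpleGraph (R.verts ⊕ R.edges) where
  Adj
    | .inl v, .inr e => (v : V) ∈ (e : Sym2 V)
    | .inr e, .inl v => (v : V) ∈ (e : Sym2 V)
    | _, _ => False
  symm := ⟨by rintro (v | e) (w | f) h <;> exact h⟩
  loopless := ⟨by rintro (v | e) h <;> exact h⟩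

/-- The components of a substructure: they partition both its vertices and its edges, and edges
hang together only through common end vertices that belong to the substructure. -/
abbrev Component (R : Substructure M) : Type _ :=
  R.incidence.ConnectedComponent

open Classical in
/-- A component of a substructure, itself regarded as a substructure. -/
noncomputable def component (R : Substructure M) (K : R.Component) : Substructure M where
  verts := R.verts.filter fun v =>
    ∃ h : v ∈ R.verts, R.incidence.connectedComponentMk (Sum.inl ⟨v, h⟩) = K
  edges := R.edges.filter fun e =>
    ∃ h : e ∈ R.edges, R.incidence.connectedComponentMk (Sum.inr ⟨e, h⟩) = K
  edges_subset := fun _ he => R.edges_subset (Finset.mem_filter.mp he).1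

/-- The graph with vertex set `W` and the edges of `R` (those with both ends in `W`). -/
def graphOn (R : Substructure M) (W : Set V) : SimpleGraph W :=
  (SimpleGraph.fromEdgeSet (R.edges : Set (Sym2 V))).induce W

/-- All the edges of `R` have both end vertices in `W`. -/
def EdgesWithin (R : Substructure M) (W : Set V) : Prop :=
  ∀ e ∈ R.edges, ∀ v ∈ e, v ∈ W

/-- A rootless tree: a tree from which one vertex `u` (the root) has been deleted, while all its
edges, including those at `u`, are kept. -/
def IsRootlessTree (R : Substructure M) : Prop :=
  ∃ u : V, u ∉ R.verts ∧ R.EdgesWithin (insert u (R.verts : Set V)) ∧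
    (R.graphOn (insert u (R.verts : Set V))).IsTree

/-- `c` runs once around a cycle all of whose edges belong to `R`. -/
def IsCycleOf (R : Substructure M) {v : V} (c : M.graph.Walk v v) : Prop :=
  c.IsCycle ∧ ∀ e ∈ c.edges, e ∈ R.edges

/-- A unicyclic graph: a connected graph (every edge has its ends among the vertices) that has
exactly one cycle. Cycles are identified with their edge sets. -/
def IsUnicyclic (R : Substructure M) : Prop :=
  R.EdgesWithin (R.verts : Set V) ∧ (R.graphOn (R.verts : Set V)).Connected ∧
    (∃ (v : V) (c : M.graph.Walk v v), R.IsCycleOf c) ∧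
    ∀ (v w : V) (c : M.graph.Walk v v) (d : M.graph.Walk w w),
      R.IsCycleOf c → R.IsCycleOf d → ∀ e, e ∈ c.edges ↔ e ∈ d.edges

/-- A unicyclic graph whose cycle belongs to `Φ₂`. -/
def IsUnicyclicPhi2 (R : Substructure M) : Prop :=
  R.IsUnicyclic ∧ ∃ (v : V) (c : M.graph.Walk v v), R.IsCycleOf c ∧ M.IsPhi2 c

/-- A unicyclic graph whose cycle belongs to `Φ₃`. -/
def IsUnicyclicPhi3 (R : Substructure M) : Prop :=
  R.IsUnicyclic ∧ ∃ (v : V) (c : M.graph.Walk v v), R.IsCycleOf c ∧ M.IsPhi3 c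

/-- A unicyclic graph whose cycle belongs to `Φ₄`. -/
def IsUnicyclicPhi4 (R : Substructure M) : Prop :=
  R.IsUnicyclic ∧ ∃ (v : V) (c : M.graph.Walk v v), R.IsCycleOf c ∧ M.IsPhi4 c

/-- A substructure of type SI: it is square and every component is a rootless tree or a unicyclic
graph that does not belong to `Φ₄`. -/
def IsSI (R : Substructure M) : Prop :=
  R.IsSquare ∧ ∀ K : R.Component, (R.component K).IsRootlessTree ∨
    ((R.component K).IsUnicyclic ∧ ¬ (R.component K).IsUnicyclicPhi4)

/-- The number `γ₁` of components that are unicyclic graphs belonging to `Φ₂`. -/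
noncomputable def gamma1 (R : Substructure M) : ℕ :=
  {K : R.Component | (R.component K).IsUnicyclicPhi2}.ncard

/-- The number `γ₂` of components that are unicyclic graphs belonging to `Φ₃`. -/
noncomputable def gamma2 (R : Substructure M) : ℕ :=
  {K : R.Component | (R.component K).IsUnicyclicPhi3}.ncard

end Substructure

end MixedGraph

/-! The Laplacian factors as `S * Sᴴ` with `S` a vertex-edge incidence matrix whose entries at
incidences have modulus 1 (`exists_isIncidence`, `IsIncidence.laplacian_eq`). By Cauchy–Binet, det
L[V₁] is the sum of |det S[V₁, Z]|² over the edge sets Z with |Z| = |V₁|, that is, over the square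
substructures (V₁, Z).

A nonzero minor requires a bijection from V₁ to Z taking each vertex to an incident edge, i.e. an
orientation φ in which every v owns the edge `s(v, φ v)`. Up to a unimodular factor the minor is
then (the conjugate of) det(1 - A), where A is the weighted matrix of φ as a partial function on V₁
(`conjTranspose_submatrix_eq`). This determinant factors over the components (`det_eq_prod`).

A connected partial function on a finite set either has a sink or contains exactly one directed
cycle. A sink gives a rootless tree and determinant 1. A cycle of excess n gives a unicyclic graph
and determinant 1 - ω^(±n) with ω = `gain` a primitive sixth root of unity, whose squared modulus is
3 on Φ₂, 4 on Φ₃, 0 on Φ₄ and 1 otherwise (`IsOrientation.classification`). Conversely, every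
substructure of type SI has an orientation, built from parent maps of spanning trees
(`IsSI.exists_isOrientation`), so none is missed. -/

/-! ### Cauchy–Binet, grouped by the image of the selecting function -/

namespace Matrix

variable {m n R : Type*} [Fintype n] [DecidableEq n] [CommRing R]

/-- Column `i` of `A * B` is a combination of the columns of `A` with coefficients `B j i`;
multilinearity selects one column `p i` for each `i`. -/
theorem det_mul_eq_sum_functions [Fintype m] (A : Matrix n m R) (B : Matrix m n R) :
    (A * B).det = ∑ p : n → m, (∏ i, B (p i) i) * (A.submatrix id p).det := by
  classical
  simp only [det_apply', mul_apply, Finset.prod_univ_sum, Finset.mul_sum, Fintype.piFinset_univ]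
  rw [Finset.sum_comm]
  refine Finset.sum_congr rfl fun p _ => Finset.sum_congr rfl fun σ _ => ?_
  simp only [Finset.prod_mul_distrib, submatrix_apply, id]
  ring

/-- One Cauchy–Binet term. Since `e` enumerates `Z` without repetition, the functions with image `Z`
are exactly the `e ∘ σ`, and the sign from permuting the columns of `A` assembles the determinant of
`B`. No order on `m` is needed. -/
theorem sum_functions_image_eq [DecidableEq m] [Fintype m] (A : Matrix n m R) (B : Matrix m n R)
    {e : n → m} (he : Function.Injective e) {Z : Finset m} (hZ : Finset.univ.image e = Z) :
    ∑ p : n → m with Finset.univ.image p = Z, (∏ i, B (p i) i) * (A.submatrix id p).det =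
      (A.submatrix id e).det * (B.submatrix e id).det := by
  rw [det_apply' (B.submatrix e id), Finset.mul_sum]
  symm
  refine Finset.sum_bij (fun (σ : Equiv.Perm n) _ => e ∘ σ) ?_ ?_ ?_ ?_
  · intro σ _
    simp only [Finset.mem_filter, Finset.mem_univ, true_and]
    rw [← hZ]
    ext x
    simp only [Finset.mem_image, Finset.mem_univ, true_and, Function.comp]
    exact ⟨fun ⟨a, h⟩ => ⟨_, h⟩, fun ⟨a, h⟩ => ⟨σ.symm a, by simpa using h⟩⟩
  · intro σ _ τ _ h
    ext x
    exact he (congrFun h x)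
  · intro p hp
    simp only [Finset.mem_filter, Finset.mem_univ, true_and] at hp
    have h1 : ∀ i, ∃ j, p j = e i := fun i => by
      have : e i ∈ Finset.univ.image p := by rw [hp, ← hZ]; simp
      simpa using this
    choose q hq using h1
    have hqi : Function.Injective q := fun a b h => he (by rw [← hq, ← hq, h])
    let τ : Equiv.Perm n := Equiv.ofBijective q (Finite.injective_iff_bijective.mp hqi)
    refine ⟨τ.symm, Finset.mem_univ _, ?_⟩
    ext x
    have : p (τ (τ.symm x)) = e (τ.symm x) := hq _
    simpa using this.symm
  · intro σ _
    have : A.submatrix id (e ∘ σ) = (A.submatrix id e).submatrix id σ := rfl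
    rw [this, det_permute']
    simp only [submatrix_apply, id, Function.comp]
    ring

theorem sum_functions_image_eq_zero [DecidableEq m] [Fintype m] (A : Matrix n m R)
    (B : Matrix m n R) {Z : Finset m}
    (hZ : ∀ e : n → m, Function.Injective e → Finset.univ.image e = Z → ∃ i, B (e i) i = 0) :
    ∑ p : n → m with Finset.univ.image p = Z, (∏ i, B (p i) i) * (A.submatrix id p).det = 0 := by
  refine Finset.sum_eq_zero fun p hp => ?_
  by_cases h : Function.Injective p
  · obtain ⟨i, hi⟩ := hZ p h (by simpa using hp)
    have h0 : ∏ i, B (p i) i = 0 := Finset.prod_eq_zero (Finset.mem_univ i) hi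
    rw [h0, zero_mul]
  · simp only [Function.Injective, not_forall] at h
    obtain ⟨i, j, hij, hne⟩ := h
    rw [det_zero_of_column_eq hne fun k => by simp [hij], mul_zero]

/-! ### Determinants of 1 - A with at most one cyclic term -/

open Classical in
/-- The matrix `1 - A`, where `A` has the entries `w x y` for related `x`, `y`. -/
noncomputable def oneSubRel (r : n → n → Prop) (w : n → n → R) : Matrix n n R :=
  of fun x y => (if x = y then 1 else 0) - if r x y then w x y else 0

/-- A permutation that moves points only along the relation `r`. -/
def Follows (r : n → n → Prop) (σ : Equiv.Perm n) : Prop :=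
  ∀ x, σ x ≠ x → r x (σ x)

omit [Fintype n] [DecidableEq n] in
theorem follows_one (r : n → n → Prop) : Follows r 1 := fun _ h => (h rfl).elim

theorem prod_oneSubRel_of_not_follows {r : n → n → Prop} (w : n → n → R) {σ : Equiv.Perm n}
    (h : ¬ Follows r σ) : ∏ x, oneSubRel r w x (σ x) = 0 := by
  simp only [Follows, not_forall] at h
  obtain ⟨x, hx, hr⟩ := h
  refine Finset.prod_eq_zero (Finset.mem_univ x) ?_
  simp [oneSubRel, hr, Ne.symm hx]

theorem prod_oneSubRel_of_follows {r : n → n → Prop} (hirr : ∀ x, ¬ r x x) (w : n → n → R)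
    {σ : Equiv.Perm n} (h : Follows r σ) :
    ∏ x, oneSubRel r w x (σ x) = (-1) ^ σ.support.card * ∏ x ∈ σ.support, w x (σ x) := by
  rw [← Finset.prod_subset (Finset.subset_univ σ.support), ← Finset.prod_const,
    ← Finset.prod_mul_distrib]
  · refine Finset.prod_congr rfl fun x hx => ?_
    have hx' := Equiv.Perm.mem_support.mp hx
    simp [oneSubRel, h x hx', Ne.symm hx']
  · intro x _ hx
    have hx' : σ x = x := by simpa using hx
    simp [oneSubRel, hx', hirr]

theorem det_eq_sum_rows (M : Matrix n n R) :
    M.det = ∑ σ : Equiv.Perm n, ((Equiv.Perm.sign σ : ℤ) : R) * ∏ x, M x (σ x) := by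
  rw [← det_transpose, det_apply']
  rfl

theorem det_oneSubRel_of_acyclic {r : n → n → Prop} (hirr : ∀ x, ¬ r x x) (w : n → n → R)
    (h : ∀ σ, Follows r σ → σ = 1) : (oneSubRel r w).det = 1 := by
  rw [det_eq_sum_rows, Finset.sum_eq_single 1]
  · rw [prod_oneSubRel_of_follows hirr w (follows_one r)]
    simp
  · intro σ _ hσ
    rw [prod_oneSubRel_of_not_follows w fun hf => hσ (h σ hf), mul_zero]
  · simp

/-- Only `1` and `c` contribute. The sign of a cycle is minus (-1) to its length, and its entries
carry another (-1) to its length, so the weight always enters with a minus sign. -/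
theorem det_oneSubRel_of_isCycle {r : n → n → Prop} (hirr : ∀ x, ¬ r x x) (w : n → n → R)
    {c : Equiv.Perm n} (hc : c.IsCycle) (hf : Follows r c)
    (h : ∀ σ, Follows r σ → σ ≠ 1 → σ = c) :
    (oneSubRel r w).det = 1 - ∏ x ∈ c.support, w x (c x) := by
  rw [det_eq_sum_rows, ← Finset.sum_subset (Finset.subset_univ {1, c}),
    Finset.sum_pair (Ne.symm hc.ne_one), prod_oneSubRel_of_follows hirr w (follows_one r),
    prod_oneSubRel_of_follows hirr w hf, hc.sign]
  · have : ((-1 : R) ^ c.support.card) * (-1) ^ c.support.card = 1 := by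
      rw [← mul_pow]; simp
    simp only [Equiv.Perm.sign_one, Equiv.Perm.support_one, Finset.card_empty, Finset.prod_empty]
    push_cast
    linear_combination (- ∏ x ∈ c.support, w x (c x)) * this
  · intro σ _ hσ
    simp only [Finset.mem_insert, Finset.mem_singleton, not_or] at hσ
    rw [prod_oneSubRel_of_not_follows w fun hf => hσ.2 (h σ hf hσ.1), mul_zero]

end Matrix

/-! ### Permutations that follow a partial function -/

section FunctionalRelation

variable {X : Type*} {r : X → X → Prop}

/-- In a right-unique relation that connects all points, every point reaches any set that is closed
under the relation and contains with each point a successor of it. -/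
theorem exists_reflTransGen_of_eqvGen (hr : Relator.RightUnique r)
    (hconn : ∀ x y, Relation.EqvGen r x y) {s : Set X} (hs : s.Nonempty)
    (hclosed : ∀ x ∈ s, ∀ y, r x y → y ∈ s) (x : X) :
    ∃ y ∈ s, Relation.ReflTransGen r x y := by
  obtain ⟨z, hz⟩ := hs
  have key : ∀ a b, Relation.EqvGen r a b →
      ((∃ y ∈ s, Relation.ReflTransGen r a y) ↔ ∃ y ∈ s, Relation.ReflTransGen r b y) := by
    intro a b h
    induction h with
    | rel a b hab =>
      refine ⟨fun ⟨y, hy, hay⟩ => ?_, fun ⟨y, hy, hby⟩ => ⟨y, hy, hby.head hab⟩⟩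
      -- If `a` is itself in `s`, closedness puts `b` in `s`; otherwise right-uniqueness forces the
      -- path to start with the step to `b`.
      rcases hay.cases_head with rfl | ⟨b', hab', hb'⟩
      · exact ⟨b, hclosed _ hy _ hab, .refl⟩
      · exact ⟨y, hy, hr hab hab' ▸ hb'⟩
    | refl => rfl
    | symm _ _ _ ih => exact ih.symm
    | trans _ _ _ _ _ ih₁ ih₂ => exact ih₁.trans ih₂
  exact (key x z (hconn x z)).mpr ⟨z, hz, .refl⟩

variable [Fintype X] [DecidableEq X]

open Matrix

omit [Fintype X] [DecidableEq X] in
theorem Matrix.Follows.rel_closed {σ : Equiv.Perm X} (hr : Relator.RightUnique r)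
    (hσ : Follows r σ) {x y : X} (hx : σ x ≠ x) (hxy : r x y) : y = σ x :=
  hr hxy (hσ x hx)

-- From a moved point the only step is the one taken by `σ`, so a path stays in its `σ`-orbit, and
-- finite order leads back to the start.
omit [DecidableEq X] in
theorem Matrix.Follows.reflTransGen {σ : Equiv.Perm X} (hr : Relator.RightUnique r)
    (hσ : Follows r σ) {x y : X} (hx : σ x ≠ x) (hxy : Relation.ReflTransGen r x y) :
    σ y ≠ y ∧ Relation.ReflTransGen r y x := by
  have back : ∀ z, σ z ≠ z → ∀ k : ℕ, Relation.ReflTransGen r z ((σ ^ k) z) := by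
    intro z hz k
    induction k with
    | zero => exact .refl
    | succ k ih =>
      refine ih.tail ?_
      rw [pow_succ', Equiv.Perm.mul_apply]
      refine hσ _ fun h => hz ?_
      rw [← Equiv.Perm.mul_apply, ← pow_succ', pow_succ, Equiv.Perm.mul_apply] at h
      exact (σ ^ k).injective h
  induction hxy with
  | refl => exact ⟨hx, .refl⟩
  | @tail b c _ hbc ih =>
    obtain rfl := hσ.rel_closed hr ih.1 hbc
    have hne : σ (σ b) ≠ σ b := fun h => ih.1 (σ.injective h)
    refine ⟨hne, Relation.ReflTransGen.trans ?_ ih.2⟩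
    -- The remaining `orderOf σ - 1` steps bring `σ b` back to `b`.
    have := back (σ b) hne (orderOf σ - 1)
    rwa [← Equiv.Perm.mul_apply, ← pow_succ, Nat.sub_add_cancel (orderOf_pos σ),
      pow_orderOf_eq_one, Equiv.Perm.one_apply] at this

/-- This is the uniqueness of the cycle. A point moved by `τ` reaches one moved by `σ` and is
reached back from it, hence is moved by `σ` too. So both move the same points, and there
right-uniqueness fixes their values. -/
theorem Matrix.Follows.eq_of_ne_one {σ τ : Equiv.Perm X} (hr : Relator.RightUnique r)
    (hconn : ∀ x y, Relation.EqvGen r x y) (hσ : Follows r σ) (hτ : Follows r τ)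
    (hσ1 : σ ≠ 1) (hτ1 : τ ≠ 1) : σ = τ := by
  have key : ∀ {σ τ : Equiv.Perm X}, Follows r σ → Follows r τ → σ ≠ 1 →
      ∀ x, τ x ≠ x → σ x ≠ x := by
    intro σ τ hσ hτ hσ1 x hx
    obtain ⟨y, hy, hxy⟩ := exists_reflTransGen_of_eqvGen hr hconn (s := {x | σ x ≠ x})
      (by
        by_contra! h
        exact hσ1 (Equiv.ext fun x => by simpa using (Set.eq_empty_iff_forall_notMem.mp h) x))
      (fun x hx y hxy => (hσ.reflTransGen hr hx (.single hxy)).1) x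
    exact (hσ.reflTransGen hr hy (hτ.reflTransGen hr hx hxy).2).1
  ext x
  by_cases hx : σ x = x
  · have : τ x = x := by
      by_contra h
      exact key hσ hτ hσ1 x h hx
    rw [hx, this]
  · exact hr (hσ x hx) (hτ x (key hτ hσ hτ1 x hx))

theorem Matrix.Follows.eq_one_of_sink {σ : Equiv.Perm X} (hr : Relator.RightUnique r)
    (hconn : ∀ x y, Relation.EqvGen r x y) (hσ : Follows r σ) {z : X} (hz : ∀ y, ¬ r z y) :
    σ = 1 := by
  ext x
  by_contra hx
  have hx' : σ x ≠ x := hx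
  obtain ⟨y, rfl, hxy⟩ := exists_reflTransGen_of_eqvGen hr hconn (s := {z}) ⟨z, rfl⟩
    (fun x hx y hxy => by obtain rfl : x = z := hx; exact (hz _ hxy).elim) x
  exact hz _ (hσ _ (hσ.reflTransGen hr hx' hxy).1)

omit [DecidableEq X] in
theorem exists_transGen_self_of_total [Nonempty X] (hr : ∀ x, ∃ y, r x y) :
    ∃ x, Relation.TransGen r x x := by
  choose g hg using hr
  obtain ⟨x⟩ := ‹Nonempty X›
  have iter : ∀ y, ∀ k : ℕ, Relation.TransGen r y (g^[k + 1] y) := by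
    intro y k
    induction k with
    | zero => exact .single (hg y)
    | succ k ih => rw [Function.iterate_succ_apply']; exact ih.tail (hg _)
  obtain ⟨i, j, hij, h⟩ := Finite.exists_ne_map_eq_of_infinite fun k : ℕ => g^[k] x
  wlog hlt : i < j generalizing i j
  · exact this j i hij.symm h.symm (by omega)
  refine ⟨g^[i] x, ?_⟩
  obtain ⟨k, rfl⟩ := Nat.exists_eq_add_of_lt hlt
  have := iter (g^[i] x) k
  rw [← Function.iterate_add_apply, show k + 1 + i = i + k + 1 by omega] at this
  change g^[i] x = g^[i + k + 1] x at h
  rwa [← h] at this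

end FunctionalRelation

/-! ### Sixth roots of unity and the weights of cycles -/

namespace MixedGraph

variable {V : Type*} {M : MixedGraph V}

/-- The primitive sixth root of unity that weighs the directed edges. -/
noncomputable def gain : ℂ := (1 + (Real.sqrt 3 : ℂ) * Complex.I) / 2

theorem sqrt_three_sq : (Real.sqrt 3 : ℂ) ^ 2 = 3 := by
  exact_mod_cast Real.sq_sqrt (by norm_num : (0 : ℝ) ≤ 3)

theorem gain_sq : gain ^ 2 = gain - 1 := by
  unfold gain
  linear_combination (Complex.I ^ 2 / 4) * sqrt_three_sq + (3 / 4) * Complex.I_sq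

theorem gain_pow_three : gain ^ 3 = -1 := by
  linear_combination (gain + 1) * gain_sq

theorem gain_ne_zero : gain ≠ 0 := fun h => by
  have := gain_pow_three
  rw [h] at this
  norm_num at this

theorem gain_inv : gain⁻¹ = (1 - (Real.sqrt 3 : ℂ) * Complex.I) / 2 := by
  refine inv_eq_of_mul_eq_one_right ?_
  unfold gain
  linear_combination (-Complex.I ^ 2 / 4) * sqrt_three_sq - (3 / 4) * Complex.I_sq

theorem conj_gain : (starRingEnd ℂ) gain = gain⁻¹ := by
  rw [gain_inv, gain]
  simp [sub_eq_add_neg, map_ofNat]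

theorem hermitianAdj_eq_gain (u v : V) [Decidable (M.arc u v)] [Decidable (M.arc v u)]
    (h : M.graph.Adj u v) :
    M.hermitianAdj u v =
      gain ^ ((if M.arc u v then 1 else 0) - (if M.arc v u then 1 else 0) : ℤ) := by
  by_cases h1 : M.arc u v
  · simp [hermitianAdj, h1, M.arc_asymm u v h1, gain]
  · by_cases h2 : M.arc v u
    · simp [hermitianAdj, h1, h2, gain_inv]
    · simp [hermitianAdj, h1, h2, h]

theorem conj_hermitianAdj (u v : V) :
    (starRingEnd ℂ) (M.hermitianAdj u v) = M.hermitianAdj v u := by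
  classical
  by_cases h : M.graph.Adj u v
  · rw [hermitianAdj_eq_gain u v h, hermitianAdj_eq_gain v u h.symm, map_zpow₀, conj_gain,
      inv_zpow', neg_sub]
  · have h1 : ¬ M.arc u v := fun h' => h (M.arc_adj _ _ h')
    have h2 : ¬ M.arc v u := fun h' => h (M.arc_adj _ _ h').symm
    have h3 : ¬ M.graph.Adj v u := fun h' => h h'.symm
    simp [hermitianAdj, h, h1, h2, h3]

theorem hermitianAdj_mul_swap {u v : V} (h : M.graph.Adj u v) :
    M.hermitianAdj u v * M.hermitianAdj v u = 1 := by
  classical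
  rw [hermitianAdj_eq_gain u v h, hermitianAdj_eq_gain v u h.symm, ← zpow_add₀ gain_ne_zero]
  simp

/-- Darts are read from head to tail because the walks concerned run against the orientation: a
dart's head owns its edge and steps to its tail. This is why the exponent becomes minus the excess.
-/
theorem prod_hermitianAdj_darts (l : List M.graph.Dart)
    [DecidablePred fun d : M.graph.Dart => M.arc d.fst d.snd]
    [DecidablePred fun d : M.graph.Dart => M.arc d.snd d.fst] :
    (l.map fun d => M.hermitianAdj d.snd d.fst).prod =
      gain ^ ((l.countP fun d => M.arc d.snd d.fst : ℕ) -
        (l.countP fun d => M.arc d.fst d.snd : ℕ) : ℤ) := by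
  classical
  induction l with
  | nil => simp
  | cons d l ih =>
    rw [List.map_cons, List.prod_cons, ih, hermitianAdj_eq_gain _ _ d.adj.symm,
      ← zpow_add₀ gain_ne_zero, List.countP_cons, List.countP_cons]
    congr 1
    push_cast
    simp only [decide_eq_true_eq]
    ring

theorem prod_hermitianAdj_walk {v : V} (c : M.graph.Walk v v) :
    (c.darts.map fun d => M.hermitianAdj d.snd d.fst).prod = gain ^ (-M.excess c) := by
  classical
  rw [prod_hermitianAdj_darts, excess, forwardCount, backwardCount, neg_sub]

theorem excess_reverse {v : V} (c : M.graph.Walk v v) : M.excess c.reverse = -M.excess c := by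
  classical
  simp only [excess, forwardCount, backwardCount, SimpleGraph.Walk.darts_reverse,
    List.countP_reverse, List.countP_map, neg_sub]
  rfl

/-- The squared modulus of `1 - w` for the weight `w` of a cycle with the given excess. -/
noncomputable def cycleFactor (n : ℤ) : ℂ := (1 - gain ^ n) * (1 - gain ^ (-n))

theorem cycleFactor_neg (n : ℤ) : cycleFactor (-n) = cycleFactor n := by
  rw [cycleFactor, cycleFactor, neg_neg, mul_comm]

theorem cycleFactor_congr {m n : ℤ} (h : m ≡ n [ZMOD 6]) : cycleFactor m = cycleFactor n := by
  have h6 : gain ^ (6 : ℤ) = 1 := by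
    have : gain ^ (6 : ℕ) = 1 := by linear_combination (gain ^ 3 - 1) * gain_pow_three
    exact_mod_cast this
  obtain ⟨k, hk⟩ := h.dvd
  obtain rfl : n = m + 6 * k := by omega
  have h1 : gain ^ (m + 6 * k) = gain ^ m := by
    rw [zpow_add₀ gain_ne_zero, zpow_mul, h6, one_zpow, mul_one]
  have h2 : gain ^ (-(m + 6 * k)) = gain ^ (-m) := by
    rw [zpow_neg, zpow_neg, h1]
  rw [cycleFactor, cycleFactor, h1, h2]

theorem cycleFactor_eq (n : ℤ) : cycleFactor n = 2 - gain ^ n - gain ^ (-n) := by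
  have : gain ^ n * gain ^ (-n) = 1 := by rw [← zpow_add₀ gain_ne_zero]; simp
  rw [cycleFactor]
  linear_combination this

theorem cycleFactor_zero : cycleFactor 0 = 0 := by simp [cycleFactor]

theorem gain_inv_eq_one_sub : gain⁻¹ = 1 - gain := by
  refine inv_eq_of_mul_eq_one_right ?_
  linear_combination -gain_sq

theorem cycleFactor_one : cycleFactor 1 = 1 := by
  rw [cycleFactor_eq, zpow_neg, zpow_one, gain_inv_eq_one_sub]
  ring

theorem cycleFactor_two : cycleFactor 2 = 3 := by
  rw [cycleFactor_eq, zpow_neg, ← inv_zpow, gain_inv_eq_one_sub]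
  norm_cast
  linear_combination (-2) * gain_sq

theorem cycleFactor_three : cycleFactor 3 = 4 := by
  rw [cycleFactor_eq, zpow_neg, ← inv_zpow, gain_inv_eq_one_sub]
  norm_cast
  linear_combination (-3) * gain_sq

theorem cycleFactor_of_isPhi2 {v : V} {c : M.graph.Walk v v} (h : M.IsPhi2 c) :
    cycleFactor (M.excess c) = 3 := by
  rcases h with h | h
  · rw [cycleFactor_congr h, cycleFactor_two]
  · rw [cycleFactor_congr (h.trans (show (4 : ℤ) ≡ -2 [ZMOD 6] by decide)), cycleFactor_neg,
      cycleFactor_two]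

theorem cycleFactor_of_isPhi3 {v : V} {c : M.graph.Walk v v} (h : M.IsPhi3 c) :
    cycleFactor (M.excess c) = 4 := by
  rw [cycleFactor_congr h, cycleFactor_three]

theorem cycleFactor_of_isPhi4 {v : V} {c : M.graph.Walk v v} (h : M.IsPhi4 c) :
    cycleFactor (M.excess c) = 0 := by
  rw [cycleFactor_congr h, cycleFactor_zero]

theorem cycleFactor_of_not {v : V} {c : M.graph.Walk v v} (h2 : ¬ M.IsPhi2 c)
    (h3 : ¬ M.IsPhi3 c) (h4 : ¬ M.IsPhi4 c) : cycleFactor (M.excess c) = 1 := by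
  have : M.excess c ≡ 1 [ZMOD 6] ∨ M.excess c ≡ -1 [ZMOD 6] := by
    simp only [IsPhi2, IsPhi3, IsPhi4, Int.ModEq] at *
    omega
  rcases this with h | h
  · rw [cycleFactor_congr h, cycleFactor_one]
  · rw [cycleFactor_congr h, cycleFactor_neg, cycleFactor_one]

end MixedGraph

/-! ### Cycles in oriented substructures -/

namespace MixedGraph.Substructure

variable {V : Type*} {M : MixedGraph V} {Q : Substructure M} {φ : V → V}

/-- `φ` orients `Q`: every edge of `Q` joins a vertex `v` of `Q` to `φ v`, for exactly one such
`v`. -/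
structure IsOrientation (Q : Substructure M) (φ : V → V) : Prop where
  mem : ∀ v ∈ Q.verts, s(v, φ v) ∈ Q.edges
  inj : ∀ v ∈ Q.verts, ∀ w ∈ Q.verts, s(v, φ v) = s(w, φ w) → v = w
  surj : ∀ e ∈ Q.edges, ∃ v ∈ Q.verts, s(v, φ v) = e

/-- The relation on the vertices of `Q` that is induced by `φ`. -/
def Step (Q : Substructure M) (φ : V → V) (x y : Q.verts) : Prop := φ x = y

theorem step_rightUnique : Relator.RightUnique (Q.Step φ) :=
  fun _ _ _ h₁ h₂ => Subtype.ext (h₁.symm.trans h₂)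

namespace IsOrientation

theorem adj (h : Q.IsOrientation φ) {v : V} (hv : v ∈ Q.verts) : M.graph.Adj v (φ v) :=
  Q.edges_subset (h.mem v hv)

theorem not_step_self (h : Q.IsOrientation φ) (x : Q.verts) : ¬ Q.Step φ x x :=
  fun hx => (h.adj x.2).ne hx.symm

theorem owner (h : Q.IsOrientation φ) {a b : V} (he : s(a, b) ∈ Q.edges) :
    (a ∈ Q.verts ∧ φ a = b) ∨ (b ∈ Q.verts ∧ φ b = a) := by
  obtain ⟨v, hv, hve⟩ := h.surj _ he
  rcases Sym2.eq_iff.mp hve with ⟨rfl, rfl⟩ | ⟨rfl, rfl⟩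
  · exact .inl ⟨hv, rfl⟩
  · exact .inr ⟨hv, rfl⟩

/-- The closed walk `c` runs against the orientation `φ`. -/
def _root_.MixedGraph.Substructure.RunsAgainst (Q : Substructure M) (φ : V → V) {v : V}
    (c : M.graph.Walk v v) : Prop :=
  ∀ d ∈ c.darts, d.snd ∈ Q.verts ∧ φ d.snd = d.fst

theorem _root_.MixedGraph.Substructure.IsCycleOf.reverse {v : V} {c : M.graph.Walk v v}
    (hc : Q.IsCycleOf c) : Q.IsCycleOf c.reverse :=
  ⟨hc.1.reverse, fun e he => hc.2 e (by simpa using he)⟩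

/-- If an edge of the cycle is owned by its later end, that vertex cannot also own the next edge,
since its two neighbours on the cycle differ. Ownership against the traversal thus spreads around
the whole cycle, or occurs nowhere. -/
theorem runsAgainst_or_reverse (h : Q.IsOrientation φ) {v : V} {c : M.graph.Walk v v}
    (hc : Q.IsCycleOf c) : Q.RunsAgainst φ c ∨ Q.RunsAgainst φ c.reverse := by
  have hlen := hc.1.three_le_length
  have own : ∀ i < c.length, (c.getVert i ∈ Q.verts ∧ φ (c.getVert i) = c.getVert (i + 1)) ∨
      (c.getVert (i + 1) ∈ Q.verts ∧ φ (c.getVert (i + 1)) = c.getVert i) := by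
    intro i hi
    refine h.owner (hc.2 _ ?_)
    have hi' : i < c.edges.length := by simpa using hi
    have : c.edges[i] = s(c.getVert i, c.getVert (i + 1)) := by
      simp [SimpleGraph.Walk.getElem_edges_eq_edge_getElem_darts,
        SimpleGraph.Walk.darts_getElem_eq_getVert]
    exact this ▸ List.getElem_mem hi'
  have step : ∀ i, i + 1 < c.length →
      (c.getVert (i + 1) ∈ Q.verts ∧ φ (c.getVert (i + 1)) = c.getVert i) →
      (c.getVert (i + 2) ∈ Q.verts ∧ φ (c.getVert (i + 2)) = c.getVert (i + 1)) := by
    intro i hi hb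
    refine (own (i + 1) hi).resolve_left fun hf => ?_
    have := hc.1.getVert_sub_one_ne_getVert_add_one (i := i + 1) (by omega)
    exact this (hb.2.symm.trans hf.2)
  -- The same propagation across the base vertex, from the last edge to the first.
  have wrap : (c.getVert (c.length - 1 + 1) ∈ Q.verts ∧
        φ (c.getVert (c.length - 1 + 1)) = c.getVert (c.length - 1)) →
      (c.getVert 1 ∈ Q.verts ∧ φ (c.getVert 1) = c.getVert 0) := by
    intro hb
    refine (own 0 (by omega)).resolve_left fun hf => ?_
    rw [Nat.sub_add_cancel (by omega), c.getVert_length] at hb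
    rw [c.getVert_zero] at hf
    exact hc.1.snd_ne_penultimate (hf.2.symm.trans hb.2)
  have up : ∀ i j, i ≤ j → j < c.length →
      (c.getVert (i + 1) ∈ Q.verts ∧ φ (c.getVert (i + 1)) = c.getVert i) →
      (c.getVert (j + 1) ∈ Q.verts ∧ φ (c.getVert (j + 1)) = c.getVert j) := by
    intro i j hij hj hb
    induction j, hij using Nat.le_induction with
    | base => exact hb
    | succ j _ ih => exact step j hj (ih (by omega))
  by_cases hex : ∃ i < c.length,
      c.getVert (i + 1) ∈ Q.verts ∧ φ (c.getVert (i + 1)) = c.getVert i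
  · obtain ⟨i, hi, hb⟩ := hex
    left
    intro d hd
    obtain ⟨j, hj, rfl⟩ := List.getElem_of_mem hd
    have h0 := wrap (up i (c.length - 1) (by omega) (by omega) hb)
    have hj' : j < c.length := by simpa using hj
    simpa [SimpleGraph.Walk.darts_getElem_eq_getVert] using up 0 j (by omega) hj' h0
  · right
    intro d hd
    rw [SimpleGraph.Walk.mem_darts_reverse] at hd
    obtain ⟨j, hj, hj2⟩ := List.getElem_of_mem hd
    have hj' : j < c.length := by simpa using hj
    have hf := (own j hj').resolve_right fun hb => hex ⟨j, hj', hb⟩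
    obtain rfl : d = (c.darts[j]).symm := by rw [hj2, SimpleGraph.Dart.symm_symm]
    simpa [SimpleGraph.Walk.darts_getElem_eq_getVert] using hf

theorem _root_.SimpleGraph.Walk.rel_of_mem_support {G : SimpleGraph V} {r : V → V → Prop}
    (hr : Equivalence r) {u v : V} (p : G.Walk u v) (h : ∀ d ∈ p.darts, r d.fst d.snd) :
    ∀ w ∈ p.support, r u w := by
  induction p with
  | nil => intro w hw; obtain rfl : w = _ := by simpa using hw
           exact hr.refl _
  | @cons a b _ hab p ih =>
    intro w hw
    rcases List.mem_cons.mp (by simpa using hw : w ∈ a :: p.support) with rfl | hw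
    · exact hr.refl _
    · refine hr.trans (h ⟨(a, b), hab⟩ (by simp)) (ih (fun d hd => h d (by simp [hd])) w hw)

theorem _root_.SimpleGraph.Walk.exists_dart_snd_eq {G : SimpleGraph V} {u v w : V}
    (p : G.Walk u v) (h : w ∈ p.support.tail) : ∃ d ∈ p.darts, d.snd = w := by
  rw [← SimpleGraph.Walk.map_snd_darts] at h
  simpa using h

theorem _root_.SimpleGraph.Walk.mem_support_tail_of_isCycle {G : SimpleGraph V} {u w : V}
    {c : G.Walk u u} (hc : c.IsCycle) (h : w ∈ c.support) : w ∈ c.support.tail := by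
  cases c with
  | nil => exact (SimpleGraph.Walk.not_isCycle_nil hc).elim
  | cons hab p =>
    simp only [SimpleGraph.Walk.support_cons, List.mem_cons, List.tail_cons] at h ⊢
    rcases h with rfl | h
    · exact p.end_mem_support
    · exact h

theorem _root_.SimpleGraph.Walk.exists_dart_fst_eq {G : SimpleGraph V} {u w : V}
    {c : G.Walk u u} (hc : c.IsCycle) (h : w ∈ c.support) : ∃ d ∈ c.darts, d.fst = w := by
  have h' : w ∈ c.reverse.support := by simpa using h
  obtain ⟨d, hd, rfl⟩ := SimpleGraph.Walk.exists_dart_snd_eq c.reverse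
    (SimpleGraph.Walk.mem_support_tail_of_isCycle hc.reverse h')
  exact ⟨d.symm, SimpleGraph.Walk.mem_darts_reverse.mp hd, rfl⟩

variable [DecidableEq V]

/-- The cyclic permutation of the vertices along a cycle that runs against the orientation. -/
theorem exists_perm (h : Q.IsOrientation φ) {v : V} {c : M.graph.Walk v v}
    (hc : c.IsCycle) (hb : Q.RunsAgainst φ c) :
    ∃ σ : Equiv.Perm Q.verts, Matrix.Follows (Q.Step φ) σ ∧ σ.IsCycle ∧
      ∀ x : Q.verts, σ x ≠ x ↔ (x : V) ∈ c.support.tail := by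
  have hsucc : ∀ w ∈ c.support.tail, w ∈ Q.verts ∧ φ w ∈ c.support.tail := by
    intro w hw
    obtain ⟨d, hd, rfl⟩ := c.exists_dart_snd_eq hw
    refine ⟨(hb d hd).1, ?_⟩
    rw [(hb d hd).2]
    exact SimpleGraph.Walk.mem_support_tail_of_isCycle hc (c.dart_fst_mem_support_of_mem_darts hd)
  -- `φ` on the cycle, the identity elsewhere; on a finite set surjectivity suffices for a
  -- permutation.
  let ψ : Q.verts → Q.verts := fun x =>
    if hx : (x : V) ∈ c.support.tail then ⟨φ x, (hsucc _ (hsucc _ hx).2).1⟩ else x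
  have hψ : Function.Surjective ψ := by
    intro y
    by_cases hy : (y : V) ∈ c.support.tail
    · obtain ⟨d, hd, hdy⟩ := SimpleGraph.Walk.exists_dart_fst_eq hc (List.mem_of_mem_tail hy)
      have hsnd : d.snd ∈ c.support.tail := SimpleGraph.Walk.mem_support_tail_of_isCycle hc
        (c.dart_snd_mem_support_of_mem_darts hd)
      refine ⟨⟨d.snd, (hb d hd).1⟩, ?_⟩
      simp only [ψ, hsnd, dif_pos]
      exact Subtype.ext ((hb d hd).2.trans hdy)
    · exact ⟨y, by simp [ψ, hy]⟩
  let σ : Equiv.Perm Q.verts := Equiv.ofBijective ψ (Finite.surjective_iff_bijective.mp hψ)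
  have hσ : ∀ x : Q.verts, (x : V) ∈ c.support.tail → ((σ x : Q.verts) : V) = φ x := by
    intro x hx
    change ((ψ x : Q.verts) : V) = φ x
    simp [ψ, hx]
  have hσ' : ∀ x : Q.verts, (x : V) ∉ c.support.tail → σ x = x := by
    intro x hx
    change ψ x = x
    simp [ψ, hx]
  have hmoved : ∀ x : Q.verts, σ x ≠ x ↔ (x : V) ∈ c.support.tail := by
    intro x
    refine ⟨fun hx => by_contra fun hx' => hx (hσ' x hx'), fun hx hx' => ?_⟩
    exact (h.adj x.2).ne ((congrArg Subtype.val hx').symm.trans (hσ x hx))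
  refine ⟨σ, fun x hx => (hσ x ((hmoved x).mp hx)).symm, ?_, hmoved⟩
  have hv : v ∈ c.support.tail :=
    SimpleGraph.Walk.mem_support_tail_of_isCycle hc c.start_mem_support
  refine ⟨⟨v, (hsucc v hv).1⟩, (hmoved _).mpr hv, fun y hy => ?_⟩
  -- `SameCycle`, enlarged by equality to an equivalence on all of `V`, so that it can be carried
  -- along the walk.
  let r : V → V → Prop := fun a b => a = b ∨
    ∃ (ha : a ∈ Q.verts) (hb : b ∈ Q.verts), σ.SameCycle ⟨a, ha⟩ ⟨b, hb⟩
  have hr : Equivalence r := by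
    refine ⟨fun _ => .inl rfl, ?_, ?_⟩
    · rintro a b (rfl | ⟨ha, hb, hab⟩)
      · exact .inl rfl
      · exact .inr ⟨hb, ha, hab.symm⟩
    · rintro a b d (rfl | ⟨ha, hb, hab⟩) (rfl | ⟨hb', hd, hbd⟩)
      · exact .inl rfl
      · exact .inr ⟨hb', hd, hbd⟩
      · exact .inr ⟨ha, hb, hab⟩
      · exact .inr ⟨ha, hd, hab.trans hbd⟩
  have := c.rel_of_mem_support hr (fun d hd => by
    have hsnd : d.snd ∈ c.support.tail := SimpleGraph.Walk.mem_support_tail_of_isCycle hc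
      (c.dart_snd_mem_support_of_mem_darts hd)
    have hfst : d.fst ∈ c.support.tail := SimpleGraph.Walk.mem_support_tail_of_isCycle hc
      (c.dart_fst_mem_support_of_mem_darts hd)
    refine .inr ⟨(hsucc _ hfst).1, (hsucc _ hsnd).1, ?_⟩
    have : σ ⟨d.snd, (hsucc _ hsnd).1⟩ = ⟨d.fst, (hsucc _ hfst).1⟩ :=
      Subtype.ext ((hσ ⟨d.snd, _⟩ hsnd).trans (hb d hd).2)
    rw [← this]
    exact (Equiv.Perm.sameCycle_apply_left).mpr (Equiv.Perm.SameCycle.refl _ _))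
    y (List.mem_of_mem_tail ((hmoved y).mp hy))
  rcases this with h' | ⟨_, _, h'⟩
  · have : y = ⟨v, (hsucc v hv).1⟩ := Subtype.ext h'.symm
    rw [this]
  · exact h'

/-- The determinant of a connected oriented substructure that contains a cycle. -/
theorem det_of_runsAgainst (h : Q.IsOrientation φ)
    (hconn : ∀ x y, Relation.EqvGen (Q.Step φ) x y) {v : V} {c : M.graph.Walk v v}
    (hc : c.IsCycle) (hb : Q.RunsAgainst φ c) :
    (Matrix.oneSubRel (Q.Step φ) fun x y => M.hermitianAdj x y).det =
      1 - gain ^ (-M.excess c) := by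
  obtain ⟨σ, hσ, hcyc, hmoved⟩ := h.exists_perm hc hb
  rw [Matrix.det_oneSubRel_of_isCycle h.not_step_self _ hcyc hσ
    fun τ hτ hτ1 => hτ.eq_of_ne_one step_rightUnique hconn hσ hτ1 hcyc.ne_one,
    ← prod_hermitianAdj_walk]
  congr 1
  -- Darts are indexed by their heads: the tail of the support lists each vertex of the cycle once,
  -- which matches the support of `σ`.
  have h1 : c.darts.map (fun d => M.hermitianAdj d.snd d.fst) =
      c.support.tail.map fun w => M.hermitianAdj w (φ w) := by
    rw [← SimpleGraph.Walk.map_snd_darts, List.map_map]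
    refine List.map_congr_left fun d hd => ?_
    simp [(hb d hd).2]
  rw [h1, ← List.prod_toFinset _ hc.support_nodup]
  refine Finset.prod_bij (fun x _ => (x : V)) ?_ ?_ ?_ ?_
  · intro x hx
    exact List.mem_toFinset.mpr ((hmoved x).mp (Equiv.Perm.mem_support.mp hx))
  · intro x _ y _ hxy
    exact Subtype.ext hxy
  · intro w hw
    have hw' := List.mem_toFinset.mp hw
    obtain ⟨d, hd, rfl⟩ := c.exists_dart_snd_eq hw'
    exact ⟨⟨d.snd, (hb d hd).1⟩, Equiv.Perm.mem_support.mpr ((hmoved _).mpr hw'), rfl⟩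
  · intro x hx
    rw [show φ x = (σ x : V) from hσ x (Equiv.Perm.mem_support.mp hx)]

theorem det_mul_conj_of_isCycleOf (h : Q.IsOrientation φ)
    (hconn : ∀ x y, Relation.EqvGen (Q.Step φ) x y) {v : V} {c : M.graph.Walk v v}
    (hc : Q.IsCycleOf c) :
    (Matrix.oneSubRel (Q.Step φ) fun x y => M.hermitianAdj x y).det *
      (starRingEnd ℂ) (Matrix.oneSubRel (Q.Step φ) fun x y => M.hermitianAdj x y).det =
      cycleFactor (M.excess c) := by
  have key : ∀ {c : M.graph.Walk v v}, Q.IsCycleOf c → Q.RunsAgainst φ c →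
    (Matrix.oneSubRel (Q.Step φ) fun x y => M.hermitianAdj x y).det *
      (starRingEnd ℂ) (Matrix.oneSubRel (Q.Step φ) fun x y => M.hermitianAdj x y).det =
      cycleFactor (M.excess c) := by
    intro c hc hb
    rw [h.det_of_runsAgainst hconn hc.1 hb, map_sub, map_one, map_zpow₀, conj_gain, inv_zpow',
      neg_neg, mul_comm, cycleFactor]
  rcases h.runsAgainst_or_reverse hc with hb | hb
  · exact key hc hb
  · rw [key hc.reverse hb, excess_reverse, cycleFactor_neg]

omit [DecidableEq V] in
theorem mem_edges_of_runsAgainst {v : V} {c : M.graph.Walk v v} (hb : Q.RunsAgainst φ c)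
    (e : Sym2 V) : e ∈ c.edges ↔ ∃ w ∈ c.support.tail, s(w, φ w) = e := by
  rw [← SimpleGraph.Walk.map_snd_darts, SimpleGraph.Walk.edges]
  simp only [List.mem_map, exists_exists_and_eq_and]
  refine exists_congr fun d => and_congr_right fun hd => ?_
  rw [(hb d hd).2, Sym2.eq_swap]
  rfl

/-- Directed against `φ`, both cycles yield nontrivial permutations following `φ`, which must
coincide; the moved vertices `w` determine the edges `s(w, φ w)`. -/
theorem isCycleOf_unique (h : Q.IsOrientation φ)
    (hconn : ∀ x y, Relation.EqvGen (Q.Step φ) x y) {v w : V} {c : M.graph.Walk v v}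
    {d : M.graph.Walk w w} (hc : Q.IsCycleOf c) (hd : Q.IsCycleOf d) (e : Sym2 V) :
    e ∈ c.edges ↔ e ∈ d.edges := by
  have key : ∀ {v w : V} {c : M.graph.Walk v v} {d : M.graph.Walk w w}, Q.IsCycleOf c →
      Q.IsCycleOf d → Q.RunsAgainst φ c → Q.RunsAgainst φ d → (e ∈ c.edges ↔ e ∈ d.edges) := by
    intro v w c d hc hd hbc hbd
    rw [mem_edges_of_runsAgainst hbc, mem_edges_of_runsAgainst hbd]
    obtain ⟨σ, hσ, hσc, hσm⟩ := h.exists_perm hc.1 hbc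
    obtain ⟨τ, hτ, hτc, hτm⟩ := h.exists_perm hd.1 hbd
    obtain rfl := hσ.eq_of_ne_one step_rightUnique hconn hτ hσc.ne_one hτc.ne_one
    refine exists_congr fun x => and_congr_left fun _ => ?_
    by_cases hx : x ∈ Q.verts
    · exact (hσm ⟨x, hx⟩).symm.trans (hτm ⟨x, hx⟩)
    · refine iff_of_false (fun hxc => hx ?_) (fun hxd => hx ?_)
      · obtain ⟨a, ha, rfl⟩ := c.exists_dart_snd_eq hxc
        exact (hbc a ha).1
      · obtain ⟨a, ha, rfl⟩ := d.exists_dart_snd_eq hxd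
        exact (hbd a ha).1
  rcases h.runsAgainst_or_reverse hc with hbc | hbc <;>
    rcases h.runsAgainst_or_reverse hd with hbd | hbd
  · exact key hc hd hbc hbd
  · simpa using key hc hd.reverse hbc hbd
  · simpa using key hc.reverse hd hbc hbd
  · simpa using key hc.reverse hd.reverse hbc hbd

theorem not_isCycleOf_of_sink (h : Q.IsOrientation φ)
    (hconn : ∀ x y, Relation.EqvGen (Q.Step φ) x y) {z : Q.verts} (hz : φ z ∉ Q.verts) {v : V}
    (c : M.graph.Walk v v) : ¬ Q.IsCycleOf c := by
  have key : ∀ c : M.graph.Walk v v, Q.IsCycleOf c → ¬ Q.RunsAgainst φ c := by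
    intro c hc hb
    obtain ⟨σ, hσ, hσc, -⟩ := h.exists_perm hc.1 hb
    exact hσc.ne_one (hσ.eq_one_of_sink step_rightUnique hconn (z := z)
      fun y hy => hz (by rw [show φ z = y from hy]; exact y.2))
  intro hc
  rcases h.runsAgainst_or_reverse hc with hb | hb
  · exact key c hc hb
  · exact key _ hc.reverse hb

theorem det_of_sink (h : Q.IsOrientation φ)
    (hconn : ∀ x y, Relation.EqvGen (Q.Step φ) x y) {z : Q.verts} (hz : φ z ∉ Q.verts) :
    (Matrix.oneSubRel (Q.Step φ) fun x y => M.hermitianAdj x y).det = 1 :=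
  Matrix.det_oneSubRel_of_acyclic h.not_step_self _ fun σ hσ =>
    hσ.eq_one_of_sink step_rightUnique hconn (z := z)
      fun y hy => hz (by rw [show φ z = y from hy]; exact y.2)

end IsOrientation

end MixedGraph.Substructure

/-! ### Shape and contribution of a connected oriented substructure -/

namespace MixedGraph.Substructure

variable {V : Type*} {M : MixedGraph V} {Q : Substructure M} {φ : V → V}

theorem fromEdgeSet_le : SimpleGraph.fromEdgeSet (Q.edges : Set (Sym2 V)) ≤ M.graph := by
  intro a b hab
  exact Q.edges_subset ((SimpleGraph.fromEdgeSet_adj _).mp hab).1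

theorem graphOn_adj {W : Set V} {a b : W} :
    (Q.graphOn W).Adj a b ↔ s((a : V), (b : V)) ∈ Q.edges := by
  refine ⟨fun h => ((SimpleGraph.fromEdgeSet_adj _).mp h).1, fun h => ?_⟩
  exact (SimpleGraph.fromEdgeSet_adj _).mpr ⟨h, SimpleGraph.Adj.ne (Q.edges_subset h)⟩

theorem isCycleOf_mapLe {v : V} {c : (SimpleGraph.fromEdgeSet (Q.edges : Set (Sym2 V))).Walk v v}
    (hc : c.IsCycle) : Q.IsCycleOf (c.mapLe fromEdgeSet_le) := by
  refine ⟨hc.mapLe _, fun e he => ?_⟩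
  rw [SimpleGraph.Walk.edges_mapLe_eq_edges] at he
  have := c.edges_subset_edgeSet he
  rw [SimpleGraph.edgeSet_fromEdgeSet] at this
  exact this.1

/-- The inclusion of `Q.graphOn W`. -/
def graphOnEmbedding (Q : Substructure M) (W : Set V) :
    Q.graphOn W ↪g SimpleGraph.fromEdgeSet (Q.edges : Set (Sym2 V)) :=
  SimpleGraph.Embedding.induce W

theorem exists_isCycleOf_of_graphOn {W : Set V} {v : W} {c : (Q.graphOn W).Walk v v}
    (hc : c.IsCycle) : ∃ c' : M.graph.Walk (v : V) v, Q.IsCycleOf c' :=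
  ⟨_, isCycleOf_mapLe (hc.map (f := (graphOnEmbedding Q W).toHom) (graphOnEmbedding Q W).injective)⟩

theorem exists_graphOn_isCycle {W : Set V} (hW : Q.EdgesWithin W) {v : V}
    {c : M.graph.Walk v v} (hc : Q.IsCycleOf c) :
    ∃ (w : W) (d : (Q.graphOn W).Walk w w), d.IsCycle := by
  have he : ∀ e ∈ c.edges, e ∈ (SimpleGraph.fromEdgeSet (Q.edges : Set (Sym2 V))).edgeSet := by
    intro e he
    rw [SimpleGraph.edgeSet_fromEdgeSet]
    exact ⟨hc.2 e he, M.graph.not_isDiag_of_mem_edgeSet (c.edges_subset_edgeSet he)⟩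
  have hs : ∀ x ∈ (c.transfer _ he).support, x ∈ W := by
    intro x hx
    rw [SimpleGraph.Walk.support_transfer] at hx
    obtain ⟨d, hd, rfl⟩ := SimpleGraph.Walk.exists_dart_fst_eq hc.1 hx
    exact hW _ (hc.2 _ (List.mem_map_of_mem hd)) _ (Sym2.mem_mk_left _ _)
  refine ⟨_, (c.transfer _ he).induce W hs,
    (SimpleGraph.Walk.isCycle_map_iff_of_injective (f := (graphOnEmbedding Q W).toHom)
      (graphOnEmbedding Q W).injective).mp ?_⟩
  have := SimpleGraph.Walk.map_induce (c.transfer _ he) hs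
  exact this.symm ▸ hc.1.transfer he

namespace IsOrientation

theorem reachable_graphOn (h : Q.IsOrientation φ) {W : Set V} (hW : ∀ v ∈ Q.verts, v ∈ W)
    {x y : Q.verts} (hxy : Relation.EqvGen (Q.Step φ) x y) :
    (Q.graphOn W).Reachable ⟨x, hW x x.2⟩ ⟨y, hW y y.2⟩ := by
  induction hxy with
  | rel a b hab =>
    refine SimpleGraph.Adj.reachable (graphOn_adj.mpr ?_)
    rw [← show φ a = b from hab]
    exact h.mem a a.2
  | refl => rfl
  | symm _ _ _ ih => exact ih.symm
  | trans _ _ _ _ _ ih₁ ih₂ => exact ih₁.trans ih₂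

variable [DecidableEq V]

/-- The root is `φ z`. No other vertex leaves `Q` under `φ`, because every vertex reaches the sink
`z`. -/
theorem isRootlessTree (h : Q.IsOrientation φ)
    (hconn : ∀ x y, Relation.EqvGen (Q.Step φ) x y) {z : Q.verts} (hz : φ z ∉ Q.verts) :
    Q.IsRootlessTree := by
  refine ⟨φ z, hz, ?_, ?_⟩
  · intro e he a ha
    obtain ⟨v, hv, rfl⟩ := h.surj e he
    rcases Sym2.mem_iff.mp ha with rfl | rfl
    · exact .inr hv
    · by_cases hv' : φ v ∈ Q.verts
      · exact .inr hv'
      obtain ⟨y, rfl, hxy⟩ := exists_reflTransGen_of_eqvGen step_rightUnique hconn (s := {z})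
        ⟨z, rfl⟩ (fun x hx y hxy => by
          obtain rfl : x = z := hx
          exact (hz (by rw [show φ x = y from hxy]; exact y.2)).elim) ⟨v, hv⟩
      rcases hxy.cases_head with rfl | ⟨b, hab, -⟩
      · exact .inl rfl
      · exact (hv' (by rw [show φ v = b from hab]; exact b.2)).elim
  · have hW : ∀ v ∈ Q.verts, v ∈ insert (φ z) (Q.verts : Set V) := fun v hv => .inr hv
    refine ⟨?_, ?_⟩
    · rw [SimpleGraph.connected_iff_exists_forall_reachable]
      refine ⟨⟨z, hW z z.2⟩, ?_⟩
      rintro ⟨w, rfl | hw⟩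
      · exact SimpleGraph.Adj.reachable (graphOn_adj.mpr (h.mem z z.2))
      · exact h.reachable_graphOn hW (hconn z ⟨w, hw⟩)
    · intro v c hc
      obtain ⟨c', hc'⟩ := exists_isCycleOf_of_graphOn hc
      exact h.not_isCycleOf_of_sink hconn hz c' hc'

theorem exists_isCycleOf [Nonempty Q.verts] (h : Q.IsOrientation φ)
    (htot : ∀ v ∈ Q.verts, φ v ∈ Q.verts) :
    ∃ (v : V) (c : M.graph.Walk v v), Q.IsCycleOf c := by
  obtain ⟨x, hx⟩ := exists_transGen_self_of_total (r := Q.Step φ)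
    fun x => ⟨⟨φ x, htot x x.2⟩, rfl⟩
  obtain ⟨y, hxy, hyx⟩ := Relation.TransGen.head'_iff.mp hx
  have hadj : ∀ a : Q.verts, (SimpleGraph.fromEdgeSet (Q.edges : Set (Sym2 V))).Adj a (φ a) :=
    fun a => (SimpleGraph.fromEdgeSet_adj _).mpr ⟨h.mem a a.2, (h.adj a.2).ne⟩
  -- The `φ`-path from `y` back to `x` avoids the edge owned by `x`, since any other vertex owns a
  -- different edge. So that edge lies on a genuine cycle; in particular φ-cycles of length 2 are
  -- impossible.
  have hreach : ((SimpleGraph.fromEdgeSet (Q.edges : Set (Sym2 V))).deleteEdges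
      {s((x : V), φ x)}).Reachable y x := by
    clear hxy
    induction hyx using Relation.ReflTransGen.head_induction_on with
    | refl => rfl
    | @head a b hab _ ih =>
      by_cases hax : a = x
      · rw [hax]
      · refine SimpleGraph.Reachable.trans (SimpleGraph.Adj.reachable ?_) ih
        rw [SimpleGraph.deleteEdges_adj, ← show φ a = b from hab]
        exact ⟨hadj a, fun he => hax (Subtype.ext (h.inj a a.2 x x.2 he))⟩
  obtain ⟨u, c, hc, -⟩ := SimpleGraph.adj_and_reachable_delete_edges_iff_exists_cycle.mp
    ⟨hadj x, by rw [show φ x = y from hxy] at hreach ⊢; exact hreach.symm⟩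
  exact ⟨u, _, isCycleOf_mapLe hc⟩

theorem isUnicyclic [Nonempty Q.verts] (h : Q.IsOrientation φ)
    (hconn : ∀ x y, Relation.EqvGen (Q.Step φ) x y) (htot : ∀ v ∈ Q.verts, φ v ∈ Q.verts) :
    Q.IsUnicyclic := by
  refine ⟨?_, ?_, h.exists_isCycleOf htot, fun v w c d hc hd e => h.isCycleOf_unique hconn hc hd e⟩
  · intro e he a ha
    obtain ⟨v, hv, rfl⟩ := h.surj e he
    rcases Sym2.mem_iff.mp ha with rfl | rfl
    · exact hv
    · exact htot v hv
  · obtain ⟨x⟩ := ‹Nonempty Q.verts›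
    rw [SimpleGraph.connected_iff_exists_forall_reachable]
    exact ⟨x, fun y => h.reachable_graphOn (fun _ hv => hv) (hconn x y)⟩

end IsOrientation

open Classical in
/-- The contribution of a component to the determinant. -/
noncomputable def factor (Q : Substructure M) : ℂ :=
  if Q.IsUnicyclicPhi4 then 0
  else (if Q.IsUnicyclicPhi2 then 3 else 1) * (if Q.IsUnicyclicPhi3 then 4 else 1)

/-- The dichotomy is whether `φ` leaves the vertex set. If it does not, every choice of cycle
evaluates the same number, so the classes Φ₂, Φ₃, Φ₄ exclude one another and `factor` is consistent.
-/
theorem IsOrientation.classification [DecidableEq V] [Nonempty Q.verts] (h : Q.IsOrientation φ)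
    (hconn : ∀ x y, Relation.EqvGen (Q.Step φ) x y) :
    (Q.IsRootlessTree ∨ Q.IsUnicyclic) ∧
      (Matrix.oneSubRel (Q.Step φ) fun x y => M.hermitianAdj x y).det *
        (starRingEnd ℂ) (Matrix.oneSubRel (Q.Step φ) fun x y => M.hermitianAdj x y).det =
      Q.factor := by
  by_cases htot : ∀ v ∈ Q.verts, φ v ∈ Q.verts
  · have huni := h.isUnicyclic hconn htot
    refine ⟨.inr huni, ?_⟩
    have key := fun v (c : M.graph.Walk v v) hc => h.det_mul_conj_of_isCycleOf hconn (c := c) hc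
    generalize (Matrix.oneSubRel (Q.Step φ) fun x y => M.hermitianAdj x y).det *
        (starRingEnd ℂ) (Matrix.oneSubRel (Q.Step φ) fun x y => M.hermitianAdj x y).det = δ at key ⊢
    have k2 : Q.IsUnicyclicPhi2 → δ = 3 := fun ⟨_, v, c, hc, hp⟩ =>
      (key v c hc).trans (cycleFactor_of_isPhi2 hp)
    have k3 : Q.IsUnicyclicPhi3 → δ = 4 := fun ⟨_, v, c, hc, hp⟩ =>
      (key v c hc).trans (cycleFactor_of_isPhi3 hp)
    have k4 : Q.IsUnicyclicPhi4 → δ = 0 := fun ⟨_, v, c, hc, hp⟩ =>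
      (key v c hc).trans (cycleFactor_of_isPhi4 hp)
    have k1 : ¬ Q.IsUnicyclicPhi2 → ¬ Q.IsUnicyclicPhi3 → ¬ Q.IsUnicyclicPhi4 → δ = 1 := by
      intro h2 h3 h4
      obtain ⟨v, c, hc⟩ := huni.2.2.1
      exact (key v c hc).trans (cycleFactor_of_not (fun hp => h2 ⟨huni, v, c, hc, hp⟩)
        (fun hp => h3 ⟨huni, v, c, hc, hp⟩) (fun hp => h4 ⟨huni, v, c, hc, hp⟩))
    unfold factor
    by_cases h4 : Q.IsUnicyclicPhi4
    · simp [h4, k4 h4]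
    · by_cases h2 : Q.IsUnicyclicPhi2
      · by_cases h3 : Q.IsUnicyclicPhi3
        · have := (k2 h2).symm.trans (k3 h3)
          norm_num at this
        · simp [h4, h2, h3, k2 h2]
      · by_cases h3 : Q.IsUnicyclicPhi3
        · simp [h4, h2, h3, k3 h3]
        · simp [h4, h2, h3, k1 h2 h3 h4]
  · push Not at htot
    obtain ⟨z, hz, hφz⟩ := htot
    have hno : ¬ Q.IsUnicyclic := fun hu => by
      obtain ⟨v, c, hc⟩ := hu.2.2.1
      exact h.not_isCycleOf_of_sink hconn (z := ⟨z, hz⟩) hφz c hc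
    refine ⟨.inl (h.isRootlessTree hconn (z := ⟨z, hz⟩) hφz), ?_⟩
    rw [h.det_of_sink hconn (z := ⟨z, hz⟩) hφz]
    simp [factor, IsUnicyclicPhi2, IsUnicyclicPhi3, IsUnicyclicPhi4, hno]

/-! ### Choosing edges in rootless trees and unicyclic graphs -/

/-- The parent is the next vertex on a shortest walk to `u`. The distance strictly drops, so no edge
is chosen from both of its ends. -/
theorem _root_.SimpleGraph.Connected.exists_parent {W : Type*} {G : SimpleGraph W}
    (hG : G.Connected) (u : W) :
    ∃ p : W → W, (∀ v, v ≠ u → G.Adj v (p v)) ∧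
      ∀ v, v ≠ u → ∀ w, w ≠ u → s(v, p v) = s(w, p w) → v = w := by
  have : ∀ v, ∃ w, v ≠ u → G.Adj v w ∧ G.dist w u < G.dist v u := by
    intro v
    obtain ⟨q, hq⟩ := hG.exists_walk_length_eq_dist v u
    cases q with
    | nil => exact ⟨u, fun h => (h rfl).elim⟩
    | @cons _ w _ hvw q =>
      refine ⟨w, fun _ => ⟨hvw, ?_⟩⟩
      have := SimpleGraph.dist_le q
      rw [SimpleGraph.Walk.length_cons] at hq
      omega
  choose p hp using this
  refine ⟨p, fun v hv => (hp v hv).1, fun v hv w hw he => ?_⟩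
  rcases Sym2.eq_iff.mp he with ⟨h, -⟩ | ⟨h₁, h₂⟩
  · exact h
  · have h3 := (hp v hv).2
    have h4 := (hp w hw).2
    rw [h₂] at h3
    rw [← h₁] at h4
    omega

/-- An injective choice of an edge of `Q` at every vertex of `Q`. -/
def IsChoice (Q : Substructure M) (φ : V → V) : Prop :=
  (∀ v ∈ Q.verts, s(v, φ v) ∈ Q.edges) ∧
    ∀ v ∈ Q.verts, ∀ w ∈ Q.verts, s(v, φ v) = s(w, φ w) → v = w

theorem IsRootlessTree.exists_isChoice (hQ : Q.IsRootlessTree) : ∃ φ, Q.IsChoice φ := by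
  classical
  obtain ⟨u, hu, -, htree⟩ := hQ
  let W : Set V := insert u (Q.verts : Set V)
  have hW : ∀ v ∈ Q.verts, v ∈ W := fun v hv => .inr hv
  obtain ⟨p, hp, hinj⟩ := htree.connected.exists_parent ⟨u, .inl rfl⟩
  let φ : V → V := fun v => if h : v ∈ W then (p ⟨v, h⟩ : V) else v
  have hφ : ∀ v (hv : v ∈ Q.verts), φ v = p ⟨v, hW v hv⟩ := fun v hv => by
    simp only [φ, hW v hv, dif_pos]
  have hne : ∀ v (hv : v ∈ Q.verts), (⟨v, hW v hv⟩ : W) ≠ ⟨u, .inl rfl⟩ := fun v hv h =>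
    hu (Subtype.mk.inj h ▸ hv)
  refine ⟨φ, fun v hv => ?_, fun v hv w hw he => ?_⟩
  · rw [hφ v hv]
    exact graphOn_adj.mp (hp _ (hne v hv))
  · rw [hφ v hv, hφ w hw] at he
    refine congrArg Subtype.val (hinj _ (hne v hv) _ (hne w hw) ?_)
    exact Sym2.map.injective Subtype.val_injective he

/-- Deleting an edge `xy` of the cycle keeps the graph connected. Vertices other than `x` choose the
edge to their parent towards `x`, and `x` takes the deleted edge, which nobody else can have chosen.
-/
theorem IsUnicyclic.exists_isChoice (hQ : Q.IsUnicyclic) : ∃ φ, Q.IsChoice φ := by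
  classical
  obtain ⟨hW, hconn, ⟨v₀, c₀, hc₀⟩, -⟩ := hQ
  obtain ⟨u, c, hc⟩ := exists_graphOn_isCycle hW hc₀
  obtain ⟨e, he⟩ : ∃ e, e ∈ c.edges := by
    refine List.exists_mem_of_ne_nil _ fun h => ?_
    have := hc.three_le_length
    rw [← SimpleGraph.Walk.length_edges, h] at this
    simp at this
  induction e with
  | h x y =>
  have hxy : (Q.graphOn (Q.verts : Set V)).Adj x y := c.adj_of_mem_edges he
  have hconn' := hconn.connected_delete_edge_of_not_isBridge
    fun hb => hb.notMem_edges_of_isCycle hc he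
  obtain ⟨p, hp, hinj⟩ := hconn'.exists_parent x
  simp only [SimpleGraph.deleteEdges_adj, Set.mem_singleton_iff] at hp
  let φ : V → V := fun v => if h : v ∈ Q.verts then
    (if (⟨v, h⟩ : (Q.verts : Set V)) = x then (y : V) else p ⟨v, h⟩) else v
  have hφ : ∀ v : (Q.verts : Set V), v ≠ x → φ v = p v := fun v hv => by
    have : (v : V) ∈ Q.verts := v.2
    simp only [φ, this, dif_pos, Subtype.coe_eta, hv, if_false]
  have hφx : φ x = y := by
    have : (x : V) ∈ Q.verts := x.2
    simp only [φ, this, dif_pos, Subtype.coe_eta, if_true]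
  have hinj2 : ∀ a b : Sym2 (Q.verts : Set V), a.map Subtype.val = b.map Subtype.val → a = b :=
    fun a b h => Sym2.map.injective Subtype.val_injective h
  have mem : ∀ v : (Q.verts : Set V), s((v : V), φ v) ∈ Q.edges := by
    intro v
    by_cases hv : v = x
    · rw [hv, hφx]
      exact graphOn_adj.mp hxy
    · rw [hφ v hv]
      exact graphOn_adj.mp (hp v hv).1
  have inj : ∀ v w : (Q.verts : Set V), s((v : V), φ v) = s((w : V), φ w) → v = w := by
    intro v w h
    by_cases hv : v = x <;> by_cases hw : w = x
    · rw [hv, hw]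
    · rw [hv, hφx, hφ w hw] at h
      exact ((hp w hw).2 (hinj2 s(w, p w) s(x, y) h.symm)).elim
    · rw [hw, hφx, hφ v hv] at h
      exact ((hp v hv).2 (hinj2 s(v, p v) s(x, y) h)).elim
    · rw [hφ v hv, hφ w hw] at h
      exact hinj v hv w hw (hinj2 s(v, p v) s(w, p w) h)
  exact ⟨φ, fun v hv => mem ⟨v, hv⟩, fun v hv w hw h => congrArg Subtype.val
    (inj ⟨v, hv⟩ ⟨w, hw⟩ h)⟩

end MixedGraph.Substructure

/-! ### Decomposition into components -/

namespace MixedGraph.Substructure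

variable {V : Type*} {M : MixedGraph V} {R : Substructure M} {φ : V → V}

/-- The component of a vertex. -/
def componentOf (R : Substructure M) (v : R.verts) : R.Component :=
  R.incidence.connectedComponentMk (.inl v)

theorem mem_component_verts {K : R.Component} {v : V} :
    v ∈ (R.component K).verts ↔ ∃ h : v ∈ R.verts, R.componentOf ⟨v, h⟩ = K := by
  simp only [component, Finset.mem_filter, componentOf]
  exact ⟨fun h => h.2, fun h => ⟨h.1, h⟩⟩

theorem mem_component_edges {K : R.Component} {e : Sym2 V} :
    e ∈ (R.component K).edges ↔
      ∃ h : e ∈ R.edges, R.incidence.connectedComponentMk (.inr ⟨e, h⟩) = K := by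
  simp only [component, Finset.mem_filter]
  exact ⟨fun h => h.2, fun h => ⟨h.1, h⟩⟩

theorem componentOf_eq {v : V} {e : Sym2 V} (hv : v ∈ R.verts) (he : e ∈ R.edges) (hve : v ∈ e) :
    R.componentOf ⟨v, hv⟩ = R.incidence.connectedComponentMk (.inr ⟨e, he⟩) :=
  SimpleGraph.ConnectedComponent.sound (SimpleGraph.Adj.reachable hve)

namespace IsOrientation

theorem component (h : R.IsOrientation φ) (K : R.Component) :
    (R.component K).IsOrientation φ where
  mem v hv := by
    obtain ⟨hv', rfl⟩ := mem_component_verts.mp hv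
    exact mem_component_edges.mpr
      ⟨h.mem v hv', (componentOf_eq hv' (h.mem v hv') (Sym2.mem_mk_left _ _)).symm⟩
  inj v hv w hw := h.inj v (mem_component_verts.mp hv).1 w (mem_component_verts.mp hw).1
  surj e he := by
    obtain ⟨he', rfl⟩ := mem_component_edges.mp he
    obtain ⟨v, hv, rfl⟩ := h.surj e he'
    exact ⟨v, mem_component_verts.mpr ⟨hv, componentOf_eq hv he' (Sym2.mem_mk_left _ _)⟩, rfl⟩

theorem nonempty_component (h : R.IsOrientation φ) (K : R.Component) :
    Nonempty (R.component K).verts := by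
  induction K using SimpleGraph.ConnectedComponent.ind with
  | h a =>
    rcases a with v | e
    · exact ⟨⟨v, mem_component_verts.mpr ⟨v.2, rfl⟩⟩⟩
    · obtain ⟨v, hv, hve⟩ := h.surj e e.2
      exact ⟨⟨v, mem_component_verts.mpr
        ⟨hv, componentOf_eq hv e.2 (hve ▸ Sym2.mem_mk_left _ _)⟩⟩⟩

theorem componentOf_eq_of_eqvGen (h : R.IsOrientation φ) {x y : R.verts}
    (hxy : Relation.EqvGen (R.Step φ) x y) : R.componentOf x = R.componentOf y := by
  induction hxy with
  | rel a b hab =>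
    have hb : (b : V) ∈ s((a : V), φ a) := by
      rw [show φ a = b from hab]
      exact Sym2.mem_mk_right _ _
    exact (componentOf_eq a.2 (h.mem a a.2) (Sym2.mem_mk_left _ _)).trans
      (componentOf_eq b.2 (h.mem a a.2) hb).symm
  | refl => rfl
  | symm _ _ _ ih => exact ih.symm
  | trans _ _ _ _ _ ih₁ ih₂ => exact ih₁.trans ih₂

/-- Retracting every edge to its owner turns a walk of incidences into a chain of `φ`-steps in
either direction. -/
theorem eqvGen_of_componentOf_eq (h : R.IsOrientation φ) {x y : R.verts}
    (hxy : R.componentOf x = R.componentOf y) : Relation.EqvGen (R.Step φ) x y := by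
  choose o ho ho' using h.surj
  let f : R.verts ⊕ R.edges → R.verts := Sum.elim id fun e => ⟨o e e.2, ho e e.2⟩
  have hadj : ∀ (v : R.verts) (e : R.edges), (v : V) ∈ (e : Sym2 V) →
      Relation.EqvGen (R.Step φ) v ⟨o e e.2, ho e e.2⟩ := by
    intro v e hve
    rw [← ho' e e.2] at hve
    rcases Sym2.mem_iff.mp hve with hv | hv
    · rw [show v = ⟨o e e.2, ho e e.2⟩ from Subtype.ext hv]
      exact .refl _
    · exact .symm _ _ (.rel _ _ hv.symm)
  have key : ∀ a b, R.incidence.Adj a b → Relation.EqvGen (R.Step φ) (f a) (f b) := by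
    rintro (v | e) (w | e') hab
    · exact hab.elim
    · exact hadj v e' hab
    · exact .symm _ _ (hadj w e hab)
    · exact hab.elim
  obtain ⟨p⟩ := SimpleGraph.ConnectedComponent.exact hxy
  have walk : ∀ {a b} (_ : R.incidence.Walk a b), Relation.EqvGen (R.Step φ) (f a) (f b) := by
    intro a b p
    induction p with
    | nil => exact .refl _
    | cons hab _ ih => exact .trans _ _ _ (key _ _ hab) ih
  exact walk p

theorem component_connected (h : R.IsOrientation φ) (K : R.Component)
    (x y : (R.component K).verts) : Relation.EqvGen ((R.component K).Step φ) x y := by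
  obtain ⟨x, hx⟩ := x
  obtain ⟨y, hy⟩ := y
  have key : ∀ {a b : R.verts}, Relation.EqvGen (R.Step φ) a b →
      ∀ (ha : (a : V) ∈ (R.component K).verts) (hb : (b : V) ∈ (R.component K).verts),
        Relation.EqvGen ((R.component K).Step φ) ⟨a, ha⟩ ⟨b, hb⟩ := by
    intro a b hab
    induction hab with
    | rel a b hab => exact fun _ _ => .rel _ _ hab
    | refl => exact fun _ _ => .refl _
    | symm _ _ _ ih => exact fun ha hb => .symm _ _ (ih hb ha)
    | trans a b _ hab _ ih₁ ih₂ =>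
      intro ha hc
      have hb : (b : V) ∈ (R.component K).verts := mem_component_verts.mpr
        ⟨b.2, (h.componentOf_eq_of_eqvGen hab).symm.trans (mem_component_verts.mp ha).2⟩
      exact .trans _ _ _ (ih₁ ha hb) (ih₂ hb hc)
  obtain ⟨hx', hxK⟩ := mem_component_verts.mp hx
  obtain ⟨hy', hyK⟩ := mem_component_verts.mp hy
  exact key (h.eqvGen_of_componentOf_eq (hxK.trans hyK.symm)) hx hy

theorem isSquare (h : R.IsOrientation φ) : R.IsSquare :=
  Finset.card_bij (fun v _ => s(v, φ v)) h.mem h.inj fun e he => by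
    obtain ⟨v, hv, hve⟩ := h.surj e he
    exact ⟨v, hv, hve⟩

noncomputable instance : Fintype R.Component := Fintype.ofFinite _

variable [DecidableEq V]

theorem det_eq_prod (h : R.IsOrientation φ) :
    (Matrix.oneSubRel (R.Step φ) fun x y => M.hermitianAdj x y).det =
      ∏ K, (Matrix.oneSubRel ((R.component K).Step φ) fun x y => M.hermitianAdj x y).det := by
  classical
  -- The matrix is block diagonal, so an arbitrary order on the components makes it block
  -- triangular.
  let _ : LinearOrder R.Component :=
    LinearOrder.lift' (Fintype.equivFin R.Component) (Fintype.equivFin R.Component).injective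
  rw [Matrix.BlockTriangular.det_fintype (b := R.componentOf)]
  · refine Finset.prod_congr rfl fun K _ => ?_
    let e : {v : R.verts // R.componentOf v = K} ≃ (R.component K).verts :=
      { toFun := fun v => ⟨v.1, mem_component_verts.mpr ⟨v.1.2, v.2⟩⟩
        invFun := fun v => ⟨⟨v, (mem_component_verts.mp v.2).1⟩, (mem_component_verts.mp v.2).2⟩
        left_inv := fun _ => rfl
        right_inv := fun _ => rfl }
    rw [← Matrix.det_submatrix_equiv_self e]
    congr 1
    ext x y
    have h1 : x.1 = y.1 ↔ e x = e y := Subtype.ext_iff.symm.trans e.injective.eq_iff.symm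
    have h2 : R.Step φ x.1 y.1 ↔ (R.component K).Step φ (e x) (e y) := Iff.rfl
    simp only [Matrix.toSquareBlock_def, Matrix.oneSubRel, Matrix.of_apply, Matrix.submatrix_apply,
      h1, h2]
    rfl
  · intro x y hxy
    have hne : x ≠ y := fun h' => hxy.ne (by rw [h'])
    have hs : ¬ R.Step φ x y := fun hs =>
      hxy.ne (h.componentOf_eq_of_eqvGen (.rel _ _ hs)).symm
    simp [Matrix.oneSubRel, hne, hs]

open Classical in
theorem det_mul_conj (h : R.IsOrientation φ) :
    (Matrix.oneSubRel (R.Step φ) fun x y => M.hermitianAdj x y).det *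
      (starRingEnd ℂ) (Matrix.oneSubRel (R.Step φ) fun x y => M.hermitianAdj x y).det =
      if R.IsSI then (3 : ℂ) ^ R.gamma1 * (4 : ℂ) ^ R.gamma2 else 0 := by
  have hcl : ∀ K, _ := fun K =>
    have := h.nonempty_component K
    (h.component K).classification (h.component_connected K)
  rw [h.det_eq_prod, map_prod, ← Finset.prod_mul_distrib,
    Finset.prod_congr rfl fun K _ => (hcl K).2]
  -- With an orientation, squareness and the shape of the components are automatic, so only Φ₄ can
  -- prevent type SI. A rootless tree is not in Φ₄ since it has no cycle.
  have hSI : R.IsSI ↔ ∀ K, ¬ (R.component K).IsUnicyclicPhi4 := by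
    refine ⟨fun hs K h4 => ?_, fun h4 => ⟨h.isSquare, fun K => (hcl K).1.imp_right
      fun hu => ⟨hu, h4 K⟩⟩⟩
    rcases hs.2 K with ht | hu
    · obtain ⟨u, -, -, ht⟩ := ht
      obtain ⟨v, c, hc⟩ := h4.1.2.2.1
      obtain ⟨w, d, hd⟩ := exists_graphOn_isCycle (W := insert u ((R.component K).verts : Set V))
        (fun e he a ha => .inr (h4.1.1 e he a ha)) hc
      exact ht.isAcyclic d hd
    · exact hu.2 h4
  split_ifs with hs
  · rw [hSI] at hs
    simp only [factor, hs, if_false]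
    rw [Finset.prod_mul_distrib, Finset.prod_ite, Finset.prod_ite]
    simp only [Finset.prod_const_one, mul_one, Finset.prod_const]
    rw [gamma1, gamma2, Set.ncard_eq_toFinset_card', Set.ncard_eq_toFinset_card']
    simp only [Set.toFinset_ofPred]
  · rw [hSI] at hs
    push Not at hs
    obtain ⟨K, hK⟩ := hs
    exact Finset.prod_eq_zero (Finset.mem_univ K) (by simp [factor, hK])

end IsOrientation

theorem IsChoice.isOrientation (hs : R.IsSquare) (h : R.IsChoice φ) : R.IsOrientation φ := by
  classical
  refine ⟨h.1, h.2, fun e he => ?_⟩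
  have himg : R.verts.image (fun v => s(v, φ v)) = R.edges := by
    refine Finset.eq_of_subset_of_card_le (Finset.image_subset_iff.mpr h.1) ?_
    rw [Finset.card_image_of_injOn fun v hv w hw => h.2 v hv w hw]
    exact hs.ge
  rw [← himg] at he
  simpa using he

/-- Choices on the components glue: an edge lies in one component only, so injectivity is local, and
squareness turns an injective choice into an orientation. -/
theorem IsSI.exists_isOrientation (h : R.IsSI) : ∃ φ, R.IsOrientation φ := by
  classical
  have : ∀ K, ∃ φ, (R.component K).IsChoice φ := fun K =>
    (h.2 K).elim (·.exists_isChoice) (·.1.exists_isChoice)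
  choose ψ hψ using this
  let φ : V → V := fun v => if hv : v ∈ R.verts then ψ (R.componentOf ⟨v, hv⟩) v else v
  have hφ : ∀ v (hv : v ∈ R.verts), φ v = ψ (R.componentOf ⟨v, hv⟩) v := fun v hv => by
    simp only [φ, hv, dif_pos]
  have hmem : ∀ v (hv : v ∈ R.verts), s(v, φ v) ∈ (R.component (R.componentOf ⟨v, hv⟩)).edges :=
    fun v hv => by
      rw [hφ v hv]
      exact (hψ _).1 v (mem_component_verts.mpr ⟨hv, rfl⟩)
  refine ⟨φ, IsChoice.isOrientation h.1 ⟨fun v hv => (mem_component_edges.mp (hmem v hv)).1,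
    fun v hv w hw he => ?_⟩⟩
  obtain ⟨h1, h1'⟩ := mem_component_edges.mp (hmem v hv)
  obtain ⟨h2, h2'⟩ := mem_component_edges.mp (hmem w hw)
  have hK : R.componentOf ⟨v, hv⟩ = R.componentOf ⟨w, hw⟩ := by
    rw [← h1', ← h2']
    simp only [he]
  refine (hψ (R.componentOf ⟨v, hv⟩)).2 v (mem_component_verts.mpr ⟨hv, rfl⟩) w
    (mem_component_verts.mpr ⟨hw, hK.symm⟩) ?_
  rw [← hφ v hv, he, hφ w hw, hK]

end MixedGraph.Substructure

/-! ### The incidence matrix and its minors -/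

namespace MixedGraph

variable {V : Type*} {M : MixedGraph V}

/-- `S` is a vertex-edge incidence matrix of `M`: it is supported on the incidences, with entries
of modulus `1`, and the two entries at an edge `uv` have the product `S u e * conj (S v e) = -N u v`
-/
structure IsIncidence (M : MixedGraph V) (S : Matrix V (Sym2 V) ℂ) : Prop where
  eq_zero : ∀ v e, ¬ (e ∈ M.graph.edgeSet ∧ v ∈ e) → S v e = 0
  mul_conj_self : ∀ u v, M.graph.Adj u v → S u s(u, v) * (starRingEnd ℂ) (S u s(u, v)) = 1
  mul_conj : ∀ u v, M.graph.Adj u v →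
    S u s(u, v) * (starRingEnd ℂ) (S v s(u, v)) = -M.hermitianAdj u v

theorem exists_isIncidence (M : MixedGraph V) : ∃ S, M.IsIncidence S := by
  classical
  have hout : ∀ e : Sym2 V, s(e.out.1, e.out.2) = e := fun e => e.out_eq
  -- An arbitrary ordering `e.out` of the ends of each edge: entry 1 at the first end, and the value
  -- forced by the product condition at the second.
  let S : Matrix V (Sym2 V) ℂ := Matrix.of fun v e =>
    if e ∈ M.graph.edgeSet then
      if v = e.out.1 then 1 else if v = e.out.2 then -M.hermitianAdj v e.out.1 else 0
    else 0
  have h1 : ∀ e ∈ M.graph.edgeSet, S e.out.1 e = 1 := fun e he => by simp [S, he]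
  have hne : ∀ e ∈ M.graph.edgeSet, M.graph.Adj e.out.1 e.out.2 := fun e he => by
    rwa [← SimpleGraph.mem_edgeSet, hout]
  have h2 : ∀ e ∈ M.graph.edgeSet, S e.out.2 e = -M.hermitianAdj e.out.2 e.out.1 := fun e he => by
    simp [S, he, (hne e he).ne']
  have hcases : ∀ u v : V, (u = s(u, v).out.1 ∧ v = s(u, v).out.2) ∨
      (u = s(u, v).out.2 ∧ v = s(u, v).out.1) := fun u v => by
    have := (hout s(u, v)).symm
    rwa [Sym2.eq_iff] at this
  have key : ∀ u v, M.graph.Adj u v →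
      (S u s(u, v) = 1 ∧ S v s(u, v) = -M.hermitianAdj v u) ∨
        (S v s(u, v) = 1 ∧ S u s(u, v) = -M.hermitianAdj u v) := by
    intro u v h
    have e1 := h1 _ (show s(u, v) ∈ M.graph.edgeSet from h)
    have e2 := h2 _ (show s(u, v) ∈ M.graph.edgeSet from h)
    rcases hcases u v with ⟨hu, hv⟩ | ⟨hu, hv⟩
    · rw [← hu] at e1 e2
      rw [← hv] at e2
      exact .inl ⟨e1, e2⟩
    · rw [← hv] at e1 e2
      rw [← hu] at e2
      exact .inr ⟨e1, e2⟩
  refine ⟨S, ?_, ?_, ?_⟩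
  · intro v e h
    by_cases he : e ∈ M.graph.edgeSet
    · have hv : v ∉ e := fun hv => h ⟨he, hv⟩
      rw [← hout e, Sym2.mem_iff, not_or] at hv
      simp [S, hv.1, hv.2]
    · simp [S, he]
  · intro u v h
    rcases key u v h with ⟨hu, -⟩ | ⟨-, hu⟩
    · simp [hu]
    · rw [hu, map_neg, neg_mul_neg, conj_hermitianAdj, hermitianAdj_mul_swap h]
  · intro u v h
    rcases key u v h with ⟨hu, hv⟩ | ⟨hv, hu⟩
    · rw [hu, hv, map_neg, conj_hermitianAdj, one_mul]
    · rw [hu, hv, map_one, mul_one]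

namespace IsIncidence

variable {S : Matrix V (Sym2 V) ℂ}

theorem mul_conj_self_of_mem (hS : M.IsIncidence S) {v : V} {e : Sym2 V}
    (he : e ∈ M.graph.edgeSet) (hv : v ∈ e) : S v e * (starRingEnd ℂ) (S v e) = 1 := by
  obtain ⟨w, rfl⟩ := hv
  exact hS.mul_conj_self v w he

open Classical in
theorem laplacian_eq [Fintype V] [DecidableEq V] (hS : M.IsIncidence S) :
    M.laplacian = S * S.conjTranspose := by
  ext u v
  rw [Matrix.mul_apply]
  simp only [Matrix.conjTranspose_apply, laplacian, degreeMatrix, Matrix.sub_apply]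
  by_cases huv : u = v
  · subst huv
    have hN : M.hermitianAdj u u = 0 := by
      have h : ¬ M.arc u u := fun h => (M.arc_adj _ _ h).ne rfl
      simp [hermitianAdj, h]
    rw [hN, sub_zero, Matrix.diagonal_apply_eq, ← SimpleGraph.card_incidenceFinset_eq_degree,
      ← Finset.sum_subset (Finset.subset_univ (M.graph.incidenceFinset u))]
    · rw [Finset.card_eq_sum_ones, Nat.cast_sum]
      refine Finset.sum_congr rfl fun e he => ?_
      rw [SimpleGraph.mem_incidenceFinset] at he
      rw [Nat.cast_one]
      exact (hS.mul_conj_self_of_mem he.1 he.2).symm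
    · intro e _ he
      rw [SimpleGraph.mem_incidenceFinset] at he
      rw [hS.eq_zero u e he, zero_mul]
  · rw [Matrix.diagonal_apply_ne _ huv, zero_sub, Finset.sum_eq_single s(u, v)]
    · by_cases h : M.graph.Adj u v
      · exact (hS.mul_conj u v h).symm
      · have h1 : ¬ M.arc u v := fun h' => h (M.arc_adj _ _ h')
        have h2 : ¬ M.arc v u := fun h' => h (M.arc_adj _ _ h').symm
        rw [hS.eq_zero u _ fun h' => h h'.1, zero_mul]
        simp [hermitianAdj, h, h1, h2]
    · intro e _ he
      by_cases hu : u ∈ e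
      · by_cases hv : v ∈ e
        · exact (he ((Sym2.mem_and_mem_iff huv).mp ⟨hu, hv⟩)).elim
        · rw [hS.eq_zero v e fun h => hv h.2, star_zero, mul_zero]
      · rw [hS.eq_zero u e fun h => hu h.2, zero_mul]
    · simp

/-- The incidence matrix of an oriented substructure, up to scaling of its columns. -/
theorem conjTranspose_submatrix_eq [DecidableEq V] (hS : M.IsIncidence S) {R : Substructure M}
    {φ : V → V} (h : R.IsOrientation φ) :
    S.conjTranspose.submatrix (fun w : R.verts => s((w : V), φ w)) (fun v : R.verts => (v : V)) =
      Matrix.diagonal (fun w : R.verts => (starRingEnd ℂ) (S w s((w : V), φ w))) *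
        Matrix.oneSubRel (R.Step φ) fun x y => M.hermitianAdj x y := by
  ext w v
  have hadj := h.adj w.2
  have h1 := hS.mul_conj_self w (φ w) hadj
  have h2 := hS.mul_conj w (φ w) hadj
  rw [Matrix.diagonal_mul]
  simp only [Matrix.submatrix_apply, Matrix.conjTranspose_apply, Matrix.oneSubRel, Matrix.of_apply]
  change (starRingEnd ℂ) _ = _
  by_cases hwv : w = v
  · subst hwv
    simp [h.not_step_self]
  · by_cases hs : R.Step φ w v
    · have hv : φ w = v := hs
      simp only [hwv, hs, if_true, if_false, zero_sub]
      rw [← hv]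
      -- The product condition solved for the entry at `φ w`, using that the entry at `w` is
      -- unimodular.
      linear_combination ((starRingEnd ℂ) (S w s((w : V), φ w))) * h2 -
        ((starRingEnd ℂ) (S (φ w) s((w : V), φ w))) * h1
    · simp only [hwv, hs, if_false, sub_zero, mul_zero]
      rw [hS.eq_zero, map_zero]
      rintro ⟨-, hv⟩
      rcases Sym2.mem_iff.mp hv with hv | hv
      · exact hwv (Subtype.ext hv.symm)
      · exact hs hv.symm

-- The two minors are conjugate, so the unimodular diagonal factor cancels.
open Classical in
theorem det_mul_det [DecidableEq V] (hS : M.IsIncidence S) {R : Substructure M}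
    {φ : V → V} (h : R.IsOrientation φ) :
    (S.submatrix (fun v : R.verts => (v : V)) (fun w : R.verts => s((w : V), φ w))).det *
      (S.conjTranspose.submatrix (fun w : R.verts => s((w : V), φ w))
        (fun v : R.verts => (v : V))).det =
      if R.IsSI then (3 : ℂ) ^ R.gamma1 * (4 : ℂ) ^ R.gamma2 else 0 := by
  rw [← h.det_mul_conj]
  have hT : S.submatrix (fun v : R.verts => (v : V)) (fun w : R.verts => s((w : V), φ w)) =
      (S.conjTranspose.submatrix (fun w : R.verts => s((w : V), φ w))
        (fun v : R.verts => (v : V))).conjTranspose := by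
    rw [Matrix.conjTranspose_submatrix, Matrix.conjTranspose_conjTranspose]
  have hd : (∏ w : R.verts, S w s((w : V), φ w)) *
      ∏ w : R.verts, (starRingEnd ℂ) (S w s((w : V), φ w)) = 1 := by
    rw [← Finset.prod_mul_distrib]
    exact Finset.prod_eq_one fun w _ => hS.mul_conj_self w (φ w) (h.adj w.2)
  rw [hT, Matrix.det_conjTranspose, hS.conjTranspose_submatrix_eq h, Matrix.det_mul,
    Matrix.det_diagonal, star_mul]
  have hstar : star (∏ w : R.verts, (starRingEnd ℂ) (S w s((w : V), φ w))) =
      ∏ w : R.verts, S w s((w : V), φ w) := by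
    change (starRingEnd ℂ) _ = _
    rw [map_prod]
    simp
  rw [hstar]
  change (starRingEnd ℂ) _ * _ * _ = _
  linear_combination ((Matrix.oneSubRel (R.Step φ) fun x y => M.hermitianAdj x y).det *
    (starRingEnd ℂ) (Matrix.oneSubRel (R.Step φ) fun x y => M.hermitianAdj x y).det) * hd

/-- A full set of incidences comes from an oriented substructure. -/
theorem exists_isOrientation (hS : M.IsIncidence S) {V₁ : Finset V} {Z : Finset (Sym2 V)}
    [DecidableEq V] {e : V₁ → Sym2 V} (he : Function.Injective e) (hZ : Finset.univ.image e = Z)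
    (hne : ∀ i, S.conjTranspose (e i) i ≠ 0) :
    ∃ (R : Substructure M) (φ : V → V), R.verts = V₁ ∧ R.edges = Z ∧ R.IsOrientation φ := by
  have hinc : ∀ i : V₁, e i ∈ M.graph.edgeSet ∧ (i : V) ∈ e i := by
    intro i
    by_contra h
    exact hne i (by rw [Matrix.conjTranspose_apply, hS.eq_zero _ _ h, star_zero])
  have hex : ∀ i : V₁, ∃ w, e i = s((i : V), w) := fun i => (hinc i).2
  choose f hf using hex
  have hsub : (Z : Set (Sym2 V)) ⊆ M.graph.edgeSet := by
    intro z hz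
    rw [← hZ] at hz
    obtain ⟨i, -, rfl⟩ := Finset.mem_image.mp hz
    exact (hinc i).1
  let φ : V → V := fun v => if hv : v ∈ V₁ then f ⟨v, hv⟩ else v
  have hφ : ∀ v (hv : v ∈ V₁), s(v, φ v) = e ⟨v, hv⟩ := fun v hv => by
    simp only [φ, hv, dif_pos]
    exact (hf ⟨v, hv⟩).symm
  refine ⟨⟨V₁, Z, hsub⟩, φ, rfl, rfl, fun v hv => ?_, fun v hv w hw h => ?_, fun z hz => ?_⟩
  · rw [hφ v hv]
    exact hZ.le (Finset.mem_image_of_mem e (Finset.mem_univ _))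
  · rw [hφ v hv, hφ w hw] at h
    exact congrArg Subtype.val (he h)
  · have hz' : z ∈ Finset.univ.image e := hZ ▸ hz
    obtain ⟨i, -, rfl⟩ := Finset.mem_image.mp hz'
    exact ⟨i, i.2, hφ i i.2⟩

open Classical in
theorem sum_functions_eq [Fintype V] [DecidableEq V] (hS : M.IsIncidence S) {R : Substructure M}
    {φ : V → V} (h : R.IsOrientation φ) :
    ∑ p : R.verts → Sym2 V with Finset.univ.image p = R.edges,
      (∏ i, (S.conjTranspose.submatrix id fun v : R.verts => (v : V)) (p i) i) *
        ((S.submatrix (fun v : R.verts => (v : V)) id).submatrix id p).det =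
      if R.IsSI then (3 : ℂ) ^ R.gamma1 * (4 : ℂ) ^ R.gamma2 else 0 := by
  rw [← hS.det_mul_det h]
  refine Matrix.sum_functions_image_eq (e := fun w : R.verts => s((w : V), φ w)) _ _
    (fun v w hvw => Subtype.ext (h.inj v v.2 w w.2 hvw)) ?_
  ext z
  simp only [Finset.mem_image, Finset.mem_univ, true_and]
  refine ⟨fun ⟨v, hv⟩ => hv ▸ h.mem v v.2, fun hz => ?_⟩
  obtain ⟨v, hv, hvz⟩ := h.surj z hz
  exact ⟨⟨v, hv⟩, hvz⟩

end IsIncidence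

end MixedGraph

/-! ### The determinant formula -/

open Classical in
theorem theorem2p7 {V : Type*} [Fintype V] [DecidableEq V] (M : MixedGraph V) (V₁ : Finset V) :
    (M.laplacian.submatrix (fun v : V₁ => (v : V)) (fun v : V₁ => (v : V))).det =
      ∑ R : M.Substructure with R.IsSI ∧ R.verts = V₁,
        (3 : ℂ) ^ R.gamma1 * (4 : ℂ) ^ R.gamma2 := by
  obtain ⟨S, hS⟩ := M.exists_isIncidence
  have hL : M.laplacian.submatrix (fun v : V₁ => (v : V)) (fun v : V₁ => (v : V)) =
      S.submatrix (fun v : V₁ => (v : V)) id *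
        S.conjTranspose.submatrix id (fun v : V₁ => (v : V)) := by
    rw [hS.laplacian_eq]
    rfl
  rw [hL, Matrix.det_mul_eq_sum_functions,
    ← Finset.sum_fiberwise Finset.univ fun p : V₁ → Sym2 V => Finset.univ.image p]
  symm
  -- Only nonzero terms are matched: an edge set whose fibre sum is nonzero comes from an oriented
  -- substructure of type SI, and with the vertex set fixed a substructure is determined by its
  -- edges.
  refine Finset.sum_bij_ne_zero (fun R _ _ => R.edges) (fun _ _ _ => Finset.mem_univ _) ?_ ?_ ?_
  · intro R₁ h₁ _ R₂ h₂ _ h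
    exact MixedGraph.Substructure.ext
      ((Finset.mem_filter.mp h₁).2.2.trans (Finset.mem_filter.mp h₂).2.2.symm) h
  · intro Z _ hZ
    have hex : ∃ e : V₁ → Sym2 V, Function.Injective e ∧ Finset.univ.image e = Z ∧
        ∀ i, S.conjTranspose (e i) i ≠ 0 := by
      by_contra! hno
      exact hZ (Matrix.sum_functions_image_eq_zero _ _ hno)
    obtain ⟨e, he, hZe, hne⟩ := hex
    obtain ⟨R, φ, rfl, rfl, hR⟩ := hS.exists_isOrientation he hZe hne
    rw [hS.sum_functions_eq hR] at hZ
    have hSI : R.IsSI := by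
      by_contra hSI
      exact hZ (if_neg hSI)
    rw [if_pos hSI] at hZ
    exact ⟨R, by simp [hSI], hZ, rfl⟩
  · intro R hR _
    obtain ⟨hSI, rfl⟩ := (Finset.mem_filter.mp hR).2
    obtain ⟨φ, hφ⟩ := hSI.exists_isOrientation
    rw [hS.sum_functions_eq hφ, if_pos hSI]
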